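/- Let $X$ be a real or complex Banach space with scalar field $\mathbb{K}$, let $\alpha$ be an isometric linear automorphism of $X$, let $B_1(X^*)$ be the closed unit ball of the dual with the weak$^*$ topology, and let $T_\alpha$ be the homeomorphism $\omega\mapsto\omega\circ\alpha$ of $B_1(X^*)$. Let $Z$ be a weak$^*$ closed subset of $B_1(X^*)$ with $T_\alpha(Z)\subseteq Z$ such that the natural linear map $X\to C(Z)$, $x\mapsto(\omega\mapsto\omega(x))$, is an isomorphism onto a closed linear subspace of $C(Z)$. Definitions. A CA embedding of $X$ is an isometric linear map $\iota:X\to Y$ into a Banach space such that for every finite $\Omega\subseteq X$ and $\delta>0$ there are an integer $d\ge1$ and contractive linear maps $\phi:X\to\ell_\infty^d$, $\psi:\ell_\infty^d\to Y$ with $\|\psi(\phi(x))-\iota(x)\|<\delta$ for all $x\in\Omega$; let $\mathrm{rc}(\Omega,\delta)$ be the least such $d$. Fix any CA embedding of $X$ (one exists: the evaluation map $X\to C(B_1(X^*))$) and put $$\mathrm{hc}(\alpha)=\sup_{\Omega\subseteq X\text{ finite}}\ \sup_{\delta>0}\ \limsup_{n\to\infty}\frac1n\log\mathrm{rc}\bigl(\Omega\cup\alpha\Omega\cup\dots\cup\alpha^{n-1}\Omega,\delta\bigr).$$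 A set $S\subseteq X$ is equivalent to the standard basis of $\ell_1^I$ if some bijection from that basis onto $S$ extends to an isomorphism $\gamma:\ell_1^I\to\overline{\mathrm{span}}\,S$, and $K$-equivalent if $\gamma$ can be chosen with $\|\gamma\|\,\|\gamma^{-1}\|\le K$. A set $I\subseteq\mathbb{Z}$ is an $\ell_1$-isomorphism set for $x\in X$ if $\{\alpha^i(x):i\in I\}$ is equivalent to the standard basis of $\ell_1^I$. The density of $I$ is $\lim_{n\to\infty}|I\cap\{-n,\dots,n\}|/(2n+1)$, when this limit exists. $\mathrm{h}_{\mathrm{top}}$ is the topological entropy of a continuous self-map of a compact Hausdorff space. A subset of $X$ is total if its linear span is dense. Then the following are equivalent: 1. $\mathrm{hc}(\alpha)>0$; 2. $\mathrm{h}_{\mathrm{top}}(T_\alpha)>0$; 3. $\mathrm{h}_{\mathrm{top}}(T_\alpha)=\infty$; 4. there exist an $x\in X$, constants $K\ge1$ and $d>0$, a sequence $(n_k)_{k\in\mathbb{N}}$ in $\mathbb{N}$ tending to infinity, and sets $I_k\subseteq\{0,1,\dots,n_k-1\}$ of cardinality at least $dn_k$ such that for each $k$ the set $\{\alpha^i(x):i\in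 I_k\}$ is $K$-equivalent to the standard basis of $\ell_1^{I_k}$; 5. there exists an $x\in X$ with an $\ell_1$-isomorphism set of positive density; 6. $\mathrm{h}_{\mathrm{top}}(T_\alpha|_Z)>0$. Moreover, for any given total subset $\Delta$ of $X$, these conditions are also equivalent to (4) with $x\in\Delta$ and to (5) with $x\in\Delta$. -/

import Mathlib

open Filter Topology

noncomputable section

namespace CAEntropy

/-! ### Contractive approximation entropy -/

section CA

variable {𝕜 X Y : Type*} [RCLike 𝕜] [NormedAddCommGroup X] [NormedSpace 𝕜 X]
  [NormedAddCommGroup Y] [NormedSpace 𝕜 Y]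

/-- `(φ, ψ, d)` belongs to `CA(γ, Ω, δ)`: the integer `d` is positive and `φ : X → ℓ_∞^d`,
`ψ : ℓ_∞^d → Y` are contractions with `‖ψ (φ x) - γ x‖ < δ` on `Ω`. The type `Fin d → 𝕜` carries
the supremum norm. -/
def IsCA (γ : X →L[𝕜] Y) (Ω : Set X) (δ : ℝ) (d : ℕ)
    (φ : X →L[𝕜] (Fin d → 𝕜)) (ψ : (Fin d → 𝕜) →L[𝕜] Y) : Prop :=
  0 < d ∧ ‖φ‖ ≤ 1 ∧ ‖ψ‖ ≤ 1 ∧ ∀ x ∈ Ω, ‖ψ (φ x) - γ x‖ < δ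

/-- A CA embedding: an isometric linear map `ι` such that `CA(ι, Ω, δ)` is nonempty for every
finite set `Ω` and every `δ > 0`. -/
def IsCAEmbedding (ι : X →ₗᵢ[𝕜] Y) : Prop :=
  ∀ (Ω : Finset X) (δ : ℝ), 0 < δ →
    ∃ (d : ℕ) (φ : X →L[𝕜] (Fin d → 𝕜)) (ψ : (Fin d → 𝕜) →L[𝕜] Y),
      IsCA ι.toContinuousLinearMap (Ω : Set X) δ d φ ψ

/-- `rc(Ω, δ)`, computed with the embedding `ι` (the infimum over the empty set is `⊤`). -/
def rc (ι : X →ₗᵢ[𝕜] Y) (Ω : Set X) (δ : ℝ) : ℕ∞ :=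
  sInf {m : ℕ∞ | ∃ (d : ℕ) (φ : X →L[𝕜] (Fin d → 𝕜)) (ψ : (Fin d → 𝕜) →L[𝕜] Y),
    IsCA ι.toContinuousLinearMap Ω δ d φ ψ ∧ m = d}

/-- The set `Ω ∪ αΩ ∪ ⋯ ∪ α^(n-1)Ω`. -/
def orbitUnion (α : X ≃ₗᵢ[𝕜] X) (Ω : Finset X) (n : ℕ) : Set X :=
  ⋃ i ∈ Finset.range n, (α ^ i : X ≃ₗᵢ[𝕜] X) '' (Ω : Set X)

/-- `hc(α, Ω, δ) = limsup (1/n) log rc(Ω ∪ αΩ ∪ ⋯ ∪ α^(n-1)Ω, δ)`. -/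
def hcAt (ι : X →ₗᵢ[𝕜] Y) (α : X ≃ₗᵢ[𝕜] X) (Ω : Finset X) (δ : ℝ) : EReal :=
  limsup (fun n : ℕ => ENNReal.log (rc ι (orbitUnion α Ω n) δ : ENNReal) / n) atTop

/-- The contractive approximation entropy `hc(α)`, computed with the CA embedding `ι`. -/
def hc (ι : X →ₗᵢ[𝕜] Y) (α : X ≃ₗᵢ[𝕜] X) : EReal :=
  ⨆ (Ω : Finset X) (δ : ℝ) (_ : 0 < δ), hcAt ι α Ω δ

end CA

/-! ### Topological entropy -/

/-- The topological entropy of a self-map of a compact Hausdorff space, with respect to the unique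
compatible uniformity. -/
def htop {K : Type*} [TopologicalSpace K] [CompactSpace K] [T2Space K] (T : K → K) : EReal :=
  letI : UniformSpace K := uniformSpaceOfCompactR1
  Dynamics.coverEntropy T Set.univ

/-- The topological entropy of the restriction of `T` to a closed invariant subset. -/
def htopRestrict {K : Type*} [TopologicalSpace K] [CompactSpace K] [T2Space K] (T : K → K)
    (Z : Set K) (hZ : IsClosed Z) (hT : Set.MapsTo T Z Z) : EReal :=
  haveI : CompactSpace Z := isCompact_iff_compactSpace.mp hZ.isCompact
  htop (hT.restrict T Z Z)

/-! ### The dual ball and the induced homeomorphism -/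

section Dual

variable (𝕜 X : Type*) [RCLike 𝕜] [NormedAddCommGroup X] [NormedSpace 𝕜 X]

/-- The closed unit ball `B_1(X^*)` of the dual, with the weak* topology. -/
abbrev DualBall : Type _ :=
  {ω : WeakDual 𝕜 X // ω ∈ WeakDual.toStrongDual ⁻¹' Metric.closedBall (0 : StrongDual 𝕜 X) 1}

instance : CompactSpace (DualBall 𝕜 X) :=
  isCompact_iff_compactSpace.mp (WeakDual.isCompact_closedBall (0 : StrongDual 𝕜 X) 1)

variable {𝕜 X}

/-- `ω ↦ ω ∘ α` on the dual ball. -/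
def dualBallMap (α : X ≃ₗᵢ[𝕜] X) (ω : DualBall 𝕜 X) : DualBall 𝕜 X :=
  ⟨StrongDual.toWeakDual
      ((WeakDual.toStrongDual ω.1).comp (α.toContinuousLinearEquiv : X →L[𝕜] X)), by
    have h : ‖WeakDual.toStrongDual ω.1‖ ≤ 1 := mem_closedBall_zero_iff.mp ω.2
    refine mem_closedBall_zero_iff.mpr
      (ContinuousLinearMap.opNorm_le_bound _ zero_le_one fun x => ?_)
    have h1 := (WeakDual.toStrongDual ω.1).le_of_opNorm_le h (α x)
    rwa [α.norm_map] at h1⟩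

theorem dualBallMap_apply (α : X ≃ₗᵢ[𝕜] X) (ω : DualBall 𝕜 X) (x : X) :
    (dualBallMap α ω).1 x = ω.1 (α x) := rfl

theorem continuous_dualBallMap (α : X ≃ₗᵢ[𝕜] X) : Continuous (dualBallMap (𝕜 := 𝕜) α) := by
  refine Continuous.subtype_mk (WeakDual.continuous_of_continuous_eval fun x => ?_) _
  exact (WeakDual.eval_continuous (α x)).comp continuous_subtype_val

/-- The weak* homeomorphism `T_α` of `B_1(X^*)`, `T_α(ω) = ω ∘ α`. -/
def dualHomeo (α : X ≃ₗᵢ[𝕜] X) : DualBall 𝕜 X ≃ₜ DualBall 𝕜 X where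
  toFun := dualBallMap α
  invFun := dualBallMap α.symm
  left_inv ω := Subtype.ext (DFunLike.ext _ _ fun x => by simp [dualBallMap_apply])
  right_inv ω := Subtype.ext (DFunLike.ext _ _ fun x => by simp [dualBallMap_apply])
  continuous_toFun := continuous_dualBallMap α
  continuous_invFun := continuous_dualBallMap α.symm

/-- The natural map `X → C(Z)`, `x ↦ (ω ↦ ω x)`, for a set `Z` of functionals in the dual ball. -/
def evalOn (Z : Set (DualBall 𝕜 X)) (x : X) : C(Z, 𝕜) where
  toFun z := z.1.1 x
  continuous_toFun :=
    (WeakDual.eval_continuous x).comp (continuous_subtype_val.comp continuous_subtype_val)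

/-- The canonical isometric embedding `X → C(B_1(X^*))`. -/
def ballEmbedding (𝕜 X : Type*) [RCLike 𝕜] [NormedAddCommGroup X] [NormedSpace 𝕜 X] :
    X →ₗᵢ[𝕜] C(DualBall 𝕜 X, 𝕜) where
  toFun x := ⟨fun ω => ω.1 x, (WeakDual.eval_continuous x).comp continuous_subtype_val⟩
  map_add' x y := by ext ω; exact map_add ω.1 x y
  map_smul' c x := by ext ω; exact map_smul ω.1 c x
  norm_map' x := by
    apply le_antisymm
    · refine (ContinuousMap.norm_le _ (norm_nonneg x)).mpr fun ω => ?_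
      have h : ‖WeakDual.toStrongDual ω.1‖ ≤ 1 := mem_closedBall_zero_iff.mp ω.2
      simpa using (WeakDual.toStrongDual ω.1).le_of_opNorm_le h x
    · obtain ⟨g, hg, hgx⟩ := exists_dual_vector'' 𝕜 x
      have h := ContinuousMap.norm_coe_le_norm
        (⟨fun ω => ω.1 x, (WeakDual.eval_continuous x).comp continuous_subtype_val⟩ :
          C(DualBall 𝕜 X, 𝕜))
        ⟨StrongDual.toWeakDual g, mem_closedBall_zero_iff.mpr hg⟩
      have h2 : ‖g x‖ = ‖x‖ := by rw [hgx]; simp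
      exact h2.symm.le.trans h

/-- The canonical embedding is a CA embedding; in particular CA embeddings exist. -/
theorem isCAEmbedding_ballEmbedding (𝕜 X : Type*) [RCLike 𝕜] [NormedAddCommGroup X]
    [NormedSpace 𝕜 X] : IsCAEmbedding (ballEmbedding 𝕜 X) := by
  intro Ω δ hδ
  let U : DualBall 𝕜 X → Set (DualBall 𝕜 X) := fun t => ⋂ x ∈ Ω, {s | ‖t.1 x - s.1 x‖ < δ / 2}
  have hUo : ∀ t, IsOpen (U t) := fun t =>
    isOpen_biInter_finset fun x _ => isOpen_lt
      ((continuous_const.sub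
        ((WeakDual.eval_continuous x).comp continuous_subtype_val)).norm) continuous_const
  have hUt : ∀ t, t ∈ U t := fun t => by simp [U, hδ]
  obtain ⟨F, hF⟩ := isCompact_univ.elim_finite_subcover U hUo
    (fun t _ => Set.mem_iUnion.mpr ⟨t, hUt t⟩)
  let e := F.equivFin
  let p : Fin F.card → DualBall 𝕜 X := fun j => (e.symm j).1
  have hcov : (Set.univ : Set (DualBall 𝕜 X)) ⊆ ⋃ j, U (p j) := by
    intro s hs
    obtain ⟨t, ht, hst⟩ := Set.mem_iUnion₂.mp (hF hs)
    exact Set.mem_iUnion.mpr ⟨e ⟨t, ht⟩, by simpa [p] using hst⟩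
  obtain ⟨f, hf⟩ := PartitionOfUnity.exists_isSubordinate_of_locallyFinite isClosed_univ
    (fun j => U (p j)) (fun j => hUo _) (locallyFinite_of_finite _) hcov
  have hsum : ∀ s, ∑ j, f j s = 1 := fun s => by
    rw [← finsum_eq_sum_of_fintype]; exact f.sum_eq_one (Set.mem_univ s)
  let φ : X →L[𝕜] (Fin F.card → 𝕜) :=
    ContinuousLinearMap.pi fun j => WeakDual.toStrongDual (p j).1
  let ψ₀ : (Fin F.card → 𝕜) →ₗ[𝕜] C(DualBall 𝕜 X, 𝕜) :=
    { toFun := fun c => ⟨fun s => ∑ j, c j * ((f j s : ℝ) : 𝕜), by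
        refine continuous_finsetSum _ fun j _ => continuous_const.mul ?_
        exact RCLike.continuous_ofReal.comp (f j).continuous⟩
      map_add' := fun a b => by
        ext s; simp [add_mul, Finset.sum_add_distrib]
      map_smul' := fun a b => by
        ext s; simp [Finset.mul_sum, mul_assoc] }
  have hψ : ∀ c, ‖ψ₀ c‖ ≤ 1 * ‖c‖ := fun c => by
    rw [one_mul]
    refine (ContinuousMap.norm_le _ (norm_nonneg c)).mpr fun s => ?_
    change ‖∑ j, c j * ((f j s : ℝ) : 𝕜)‖ ≤ ‖c‖
    calc ‖∑ j, c j * ((f j s : ℝ) : 𝕜)‖ ≤ ∑ j, ‖c‖ * f j s := by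
          refine norm_sum_le_of_le _ fun j _ => ?_
          rw [norm_mul, RCLike.norm_ofReal, abs_of_nonneg (f.nonneg j s)]
          exact mul_le_mul_of_nonneg_right (norm_le_pi_norm c j) (f.nonneg j s)
      _ = ‖c‖ := by rw [← Finset.mul_sum, hsum, mul_one]
  refine ⟨F.card, φ, ψ₀.mkContinuous 1 hψ, ?_, ?_, ψ₀.mkContinuous_norm_le zero_le_one hψ, ?_⟩
  · obtain ⟨t, ht, -⟩ := Set.mem_iUnion₂.mp
      (hF (Set.mem_univ (⟨0, mem_closedBall_zero_iff.mpr (by simp)⟩ : DualBall 𝕜 X)))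
    exact Finset.card_pos.mpr ⟨t, ht⟩
  · refine ContinuousLinearMap.opNorm_le_bound _ zero_le_one fun x => ?_
    rw [one_mul]
    refine (pi_norm_le_iff_of_nonneg (norm_nonneg x)).mpr fun j => ?_
    have h : ‖WeakDual.toStrongDual (p j).1‖ ≤ 1 := mem_closedBall_zero_iff.mp (p j).2
    simpa [φ] using (WeakDual.toStrongDual (p j).1).le_of_opNorm_le h x
  · intro x hx
    refine lt_of_le_of_lt ?_ (half_lt_self hδ)
    refine (ContinuousMap.norm_le _ (half_pos hδ).le).mpr fun s => ?_
    change ‖(∑ j, (p j).1 x * ((f j s : ℝ) : 𝕜)) - s.1 x‖ ≤ δ / 2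
    have h1 : s.1 x = ∑ j, s.1 x * ((f j s : ℝ) : 𝕜) := by
      rw [← Finset.mul_sum, ← RCLike.ofReal_sum, hsum]; simp
    rw [h1, ← Finset.sum_sub_distrib]
    calc _ ≤ ∑ j, δ / 2 * f j s := by
          refine norm_sum_le_of_le _ fun j _ => ?_
          rw [← sub_mul, norm_mul, RCLike.norm_ofReal, abs_of_nonneg (f.nonneg j s)]
          by_cases h0 : f j s = 0
          · simp [h0]
          · have hs : s ∈ U (p j) := hf j (subset_tsupport _ h0)
            exact mul_le_mul_of_nonneg_right
              (le_of_lt (Set.mem_iInter₂.mp hs x hx)) (f.nonneg j s)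
      _ = δ / 2 := by rw [← Finset.mul_sum, hsum, mul_one]

end Dual

/-! ### Sets equivalent to the standard basis of `ℓ₁` -/

section EllOne

variable (𝕜 : Type*) {X : Type*} [RCLike 𝕜] [NormedAddCommGroup X] [NormedSpace 𝕜 X]

open Classical in
/-- An isomorphism `γ` from `ℓ₁^I` onto the closed linear span of `S` which restricts to a bijection
from the standard basis onto `S`. -/
def MapsBasisOnto (I : Type*) (S : Set X)
    (γ : lp (fun _ : I => 𝕜) 1 ≃L[𝕜] (Submodule.span 𝕜 S).topologicalClosure) : Prop :=
  Set.BijOn (fun i : I => (γ (lp.single 1 i (1 : 𝕜)) : X)) Set.univ S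

/-- The set `S` is equivalent to the standard basis of `ℓ₁^I`. -/
def EquivStdBasis (I : Type*) (S : Set X) : Prop :=
  ∃ γ, MapsBasisOnto 𝕜 I S γ

/-- The set `S` is `C`-equivalent to the standard basis of `ℓ₁^I`. -/
def EquivStdBasisWith (C : ℝ) (I : Type*) (S : Set X) : Prop :=
  ∃ γ, MapsBasisOnto 𝕜 I S γ ∧
    ‖(γ : lp (fun _ : I => 𝕜) 1 →L[𝕜] (Submodule.span 𝕜 S).topologicalClosure)‖ *
      ‖(γ.symm : (Submodule.span 𝕜 S).topologicalClosure →L[𝕜] lp (fun _ : I => 𝕜) 1)‖ ≤ C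

variable {𝕜}

/-- `I ⊆ ℤ` is an `ℓ₁`-isomorphism set for `x`. -/
def IsEllOneIsomorphismSet (α : X ≃ₗᵢ[𝕜] X) (x : X) (I : Set ℤ) : Prop :=
  EquivStdBasis 𝕜 I ((fun i : ℤ => (α ^ i : X ≃ₗᵢ[𝕜] X) x) '' I)

/-- The orbit of `x` has pieces of proportional size that are uniformly equivalent to standard
bases of finite-dimensional `ℓ₁`-spaces. -/
def HasProportionalEllOnePieces (α : X ≃ₗᵢ[𝕜] X) (x : X) : Prop :=
  ∃ (C : ℝ) (d : ℝ) (n : ℕ → ℕ) (I : ℕ → Finset ℕ), 1 ≤ C ∧ 0 < d ∧ Tendsto n atTop atTop ∧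
    ∀ k, I k ⊆ Finset.range (n k) ∧ d * (n k : ℝ) ≤ ((I k).card : ℝ) ∧
      EquivStdBasisWith 𝕜 C (I k) ((fun i : ℕ => (α ^ i : X ≃ₗᵢ[𝕜] X) x) '' (I k : Set ℕ))

end EllOne

/-- The set `I ⊆ ℤ` has density `D`: the proportions of `I` in `{-n, …, n}` converge to `D`. -/
def HasDensity (I : Set ℤ) (D : ℝ) : Prop :=
  Tendsto (fun n : ℕ => ((I ∩ Set.Icc (-(n : ℤ)) (n : ℤ)).ncard : ℝ) / (2 * (n : ℝ) + 1))
    atTop (𝓝 D)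

/-- `x` has an `ℓ₁`-isomorphism set of positive density. -/
def HasPositiveDensityEllOneSet {𝕜 X : Type*} [RCLike 𝕜] [NormedAddCommGroup X] [NormedSpace 𝕜 X]
    (α : X ≃ₗᵢ[𝕜] X) (x : X) : Prop :=
  ∃ (I : Set ℤ) (D : ℝ), 0 < D ∧ HasDensity I D ∧ IsEllOneIsomorphismSet α x I

end CAEntropy

end

noncomputable section

namespace CAEntropy

/-! ### A Sauer–Shelah lemma for families of disjoint pairs -/

section Shatter

variable {P ι : Type*}

/-! Everything passes through one quantitative property, `HasProportionalLower`: for infinitely many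
`n`, the orbit of `x` over a set of times of proportional size in `{0, …, n-1}` satisfies a lower
`ℓ₁`-estimate with a fixed constant.

From entropy to `ℓ₁`: by compactness an entourage of a closed invariant set of functionals is
controlled by finitely many vectors of `Δ`, and the values of functionals on these vectors by a
finite net in the scalars. A Sauer–Shelah dichotomy (`exists_shatters_or_patterns`) then leaves two
cases. Either functionals take values near two distant net points independently over a proportional
set of times, or so few patterns occur that they yield dynamical covers growing more slowly than the
entropy allows. The second case is excluded, and independence gives the lower estimate
(`ellOneLower_of_independent`). This is `exists_hasProportionalLower_of_htop_pos`.

From `ℓ₁` to entropy: if finitely many bounded functionals almost norm the span of the chosen orbit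
points, every choice of signs must give a large sum against one of them. Hoeffding's bound for
random signs makes them exponentially many (`exp_le_card_of_sign_sums`). Applied to the coordinates
of a factorization through `ℓ_∞^d` this bounds `hc` below; applied to the points of a dynamical
cover it bounds topological entropy below, on any system that norms `X` up to a constant. On the
whole dual ball, Hahn–Banach realizes every small pattern of values, so the entropy is even
infinite. The inequality `hc_le_htop` closes the circle.

Positive density: the finite sets of times with a given lower estimate form a hereditary,
translation invariant family. Fekete's lemma and an ultrafilter limit of its members produce an
infinite set of exact density (`exists_set_of_density`). -/

/-- The index set `J` is shattered by `S` with respect to the pairs `(A i, B i)`. -/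
def Shatters (A B : ι → Set P) (S : Set P) (J : Finset ι) : Prop :=
  ∀ σ : ι → Bool, ∃ p ∈ S, ∀ j ∈ J, (σ j = true → p ∈ A j) ∧ (σ j = false → p ∈ B j)

open Classical in
/-- The subsets of `I` shattered by `S`. -/
def shattered (A B : ι → Set P) (S : Set P) (I : Finset ι) : Finset (Finset ι) :=
  I.powerset.filter (Shatters A B S)

theorem Shatters.mono {A B : ι → Set P} {S S' : Set P} {J : Finset ι} (h : Shatters A B S J)
    (hS : S ⊆ S') : Shatters A B S' J := fun σ =>
  let ⟨p, hp, hJ⟩ := h σ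
  ⟨p, hS hp, hJ⟩

theorem mem_shattered {A B : ι → Set P} {S : Set P} {I J : Finset ι} :
    J ∈ shattered A B S I ↔ J ⊆ I ∧ Shatters A B S J := by
  simp [shattered]

theorem shattered_mono {A B : ι → Set P} {S S' : Set P} {I I' : Finset ι} (hS : S ⊆ S')
    (hI : I ⊆ I') : shattered A B S I ⊆ shattered A B S' I' := fun J hJ => by
  rw [mem_shattered] at hJ ⊢
  exact ⟨hJ.1.trans hI, hJ.2.mono hS⟩

/-- Pajor's argument. A set shattered by either half is shattered by `S`; one shattered by both
halves remains shattered after `i` is added, since either value at `i` can be prescribed. The sets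
with `i` added are new, as the others avoid `i`, so inclusion–exclusion gives the count. -/
theorem card_shattered_add_le [DecidableEq ι] (A B : ι → Set P) (S : Set P) {I : Finset ι} {i : ι} (hi : i ∉ I) :
    (shattered A B (S ∩ A i) I).card + (shattered A B (S ∩ B i) I).card ≤
      (shattered A B S (insert i I)).card := by
  rw [← Finset.card_union_add_card_inter]
  have hinj : Set.InjOn (insert i) (shattered A B (S ∩ A i) I ∩ shattered A B (S ∩ B i) I :
      Set (Finset ι)) := by
    intro J hJ J' hJ' h
    have h1 : i ∉ J := fun h => hi ((mem_shattered.mp hJ.1).1 h)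
    have h2 : i ∉ J' := fun h => hi ((mem_shattered.mp hJ'.1).1 h)
    rw [← Finset.erase_insert h1, ← Finset.erase_insert h2, h]
  rw [← Finset.card_image_of_injOn (s := shattered A B (S ∩ A i) I ∩ shattered A B (S ∩ B i) I)
    (f := insert i) (by simpa using hinj), ← Finset.card_union_of_disjoint]
  · refine Finset.card_le_card (Finset.union_subset (Finset.union_subset ?_ ?_) ?_)
    · exact shattered_mono Set.inter_subset_left (Finset.subset_insert _ _)
    · exact shattered_mono Set.inter_subset_left (Finset.subset_insert _ _)
    · intro J' hJ'
      obtain ⟨J, hJ, rfl⟩ := Finset.mem_image.mp hJ'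
      rw [Finset.mem_inter, mem_shattered, mem_shattered] at hJ
      refine mem_shattered.mpr ⟨Finset.insert_subset_insert _ hJ.1.1, fun σ => ?_⟩
      cases hσ : σ i
      · obtain ⟨p, hp, h⟩ := hJ.2.2 σ
        exact ⟨p, hp.1, (Finset.forall_mem_insert _ _ _).mpr ⟨by simp [hσ, hp.2], h⟩⟩
      · obtain ⟨p, hp, h⟩ := hJ.1.2 σ
        exact ⟨p, hp.1, (Finset.forall_mem_insert _ _ _).mpr ⟨by simp [hσ, hp.2], h⟩⟩
  · rw [Finset.disjoint_left]
    intro J hJ hJ'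
    obtain ⟨J₀, -, rfl⟩ := Finset.mem_image.mp hJ'
    have : insert i J₀ ⊆ I := by
      rcases Finset.mem_union.mp hJ with h | h <;> exact (mem_shattered.mp h).1
    exact hi (this (Finset.mem_insert_self _ _))

/-- If `S` shatters fewer than `2 ^ M` subsets of `I`, then few sign patterns suffice to choose,
for each point of `S` and each index, a member of the pair avoided by that point. -/
theorem exists_patterns_of_card_shattered_lt [DecidableEq ι] {A B : ι → Set P} (hAB : ∀ i, Disjoint (A i) (B i))
    (I : Finset ι) : ∀ (S : Set P) (M : ℕ), (shattered A B S I).card < 2 ^ M →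
      ∃ F : Finset (ι → Bool), F.card ≤ ∑ j ∈ Finset.range M, I.card.choose j ∧
        ∀ p ∈ S, ∃ σ ∈ F, ∀ i ∈ I, (σ i = true → p ∉ B i) ∧ (σ i = false → p ∉ A i) := by
  classical
  have zero_case : ∀ (I : Finset ι) (S : Set P), (shattered A B S I).card < 2 ^ 0 → S = ∅ := by
    intro I S h
    rw [pow_zero, Nat.lt_one_iff, Finset.card_eq_zero] at h
    by_contra hS
    obtain ⟨p, hp⟩ := Set.nonempty_iff_ne_empty.mpr hS
    have : ∅ ∈ shattered A B S I := mem_shattered.mpr ⟨by simp, fun σ => ⟨p, hp, by simp⟩⟩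
    simp [h] at this
  induction I using Finset.induction_on with
  | empty =>
    intro S M h
    rcases M with _ | M
    · exact ⟨∅, by simp, by simp [zero_case _ _ h]⟩
    · refine ⟨{fun _ => true}, ?_, by simp⟩
      rw [Finset.sum_range_succ']
      simp
  | insert i I hi ih =>
    intro S M h
    rcases M with _ | M
    · exact ⟨∅, by simp, by simp [zero_case _ _ h]⟩
    have hsum := card_shattered_add_le A B S hi
    -- Points outside `D` receive the value `b` at `i`, points in `D` the value `!b`, which is
    -- admissible because the pair is disjoint. Only the points in `D` need the smaller budget `M`;
    -- the two binomial sums then add up by Pascal's rule.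
    have key : ∀ (b : Bool) (D : Set P), (shattered A B (S ∩ D) I).card < 2 ^ M →
        (b = true → D = B i) → (b = false → D = A i) →
        ∃ F : Finset (ι → Bool),
          F.card ≤ ∑ j ∈ Finset.range (M + 1), (insert i I).card.choose j ∧
          ∀ p ∈ S, ∃ σ ∈ F, ∀ k ∈ insert i I,
            (σ k = true → p ∉ B k) ∧ (σ k = false → p ∉ A k) := by
      intro b D hD ht hf
      obtain ⟨F₁, hF₁, h₁⟩ := ih (S \ D) (M + 1) (lt_of_le_of_lt (Finset.card_le_card
        (shattered_mono Set.sdiff_subset (Finset.subset_insert _ _))) h)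
      obtain ⟨F₂, hF₂, h₂⟩ := ih (S ∩ D) M hD
      have hupd : ∀ (σ : ι → Bool) (b : Bool), ∀ k ∈ I, Function.update σ i b k = σ k :=
        by
        intro σ b k hk
        have hki : k ≠ i := by rintro rfl; exact hi hk
        exact Function.update_of_ne hki _ _
      refine ⟨F₁.image (fun σ => Function.update σ i b) ∪
        F₂.image (fun σ => Function.update σ i (!b)), ?_, ?_⟩
      · refine (Finset.card_union_le _ _).trans ((add_le_add Finset.card_image_le
          Finset.card_image_le).trans ((add_le_add hF₁ hF₂).trans (le_of_eq ?_)))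
        rw [Finset.card_insert_of_notMem hi, Finset.sum_range_succ', Finset.sum_range_succ']
        simp only [Nat.choose_succ_succ, Finset.sum_add_distrib, Nat.choose_zero_right]
        ring
      · intro p hp
        by_cases hpD : p ∈ D
        · obtain ⟨σ, hσ, h⟩ := h₂ p ⟨hp, hpD⟩
          refine ⟨_, Finset.mem_union_right _ (Finset.mem_image_of_mem _ hσ),
            (Finset.forall_mem_insert _ _ _).mpr ⟨?_, fun k hk => by
              rw [hupd σ _ k hk]; exact h k hk⟩⟩
          cases b
          · rw [hf rfl] at hpD
            simpa using Set.disjoint_left.mp (hAB i) hpD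
          · rw [ht rfl] at hpD
            simpa using Set.disjoint_right.mp (hAB i) hpD
        · obtain ⟨σ, hσ, h⟩ := h₁ p ⟨hp, hpD⟩
          refine ⟨_, Finset.mem_union_left _ (Finset.mem_image_of_mem _ hσ),
            (Finset.forall_mem_insert _ _ _).mpr ⟨?_, fun k hk => by
              rw [hupd σ _ k hk]; exact h k hk⟩⟩
          cases b
          · rw [hf rfl] at hpD
            simpa using hpD
          · rw [ht rfl] at hpD
            simpa using hpD
    -- The two halves together shatter fewer than `2 ^ (M + 1)` sets, so one of them shatters fewer
    -- than `2 ^ M` and serves as `D`.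
    rw [pow_succ] at h
    rcases lt_or_ge (shattered A B (S ∩ B i) I).card (2 ^ M) with hB | hB
    · exact key true (B i) hB (by simp) (by simp)
    · exact key false (A i) (by omega) (by simp) (by simp)

end Shatter

/-! ### Numerical estimates -/

/-- Chernoff weighting: inserting `t ^ j` costs at most `exp (b N / 2)` for `j ≤ c N`, while the
weighted sum is at most `(1 + t) ^ N ≤ exp (b N / 2)`. -/
theorem sum_choose_le_exp {b : ℝ} (hb : 0 < b) :
    ∃ c : ℝ, 0 < c ∧ ∀ N M : ℕ, (M : ℝ) ≤ c * N + 1 →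
      ((∑ j ∈ Finset.range M, N.choose j : ℕ) : ℝ) ≤ Real.exp (b * N) := by
  set t : ℝ := min (b / 2) (1 / 2) with ht
  have ht0 : 0 < t := lt_min (by linarith) (by norm_num)
  have ht1 : t < 1 := lt_of_le_of_lt (min_le_right _ _) (by norm_num)
  have htb : t ≤ b / 2 := min_le_left _ _
  have hlog : 0 < -Real.log t := by linarith [Real.log_neg ht0 ht1]
  refine ⟨b / 2 / (-Real.log t), by positivity, fun N M hM => ?_⟩
  have h1 : ∀ j ∈ Finset.range M, (N.choose j : ℝ) ≤
      Real.exp (b / 2 * N) * (t ^ j * N.choose j) := by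
    intro j hj
    have hjM : (j : ℝ) + 1 ≤ M := by exact_mod_cast Finset.mem_range.mp hj
    have hj : (j : ℝ) * (-Real.log t) ≤ b / 2 * N := by
      have : (j : ℝ) ≤ b / 2 / (-Real.log t) * N := by linarith
      rw [div_mul_eq_mul_div, le_div_iff₀ hlog] at this
      exact this
    rw [← mul_assoc]
    refine le_mul_of_one_le_left (Nat.cast_nonneg _) ?_
    have hpow : t ^ j = Real.exp (j * Real.log t) := by
      rw [Real.exp_nat_mul, Real.exp_log ht0]
    rw [hpow, ← Real.exp_add]
    exact Real.one_le_exp (by linarith)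
  have h2 : ∑ j ∈ Finset.range M, t ^ j * (N.choose j : ℝ) ≤ (t + 1) ^ N := by
    rw [add_pow]
    rcases le_total M (N + 1) with h | h
    · refine (Finset.sum_le_sum_of_subset_of_nonneg (Finset.range_subset_range.mpr h)
        fun _ _ _ => by positivity).trans (le_of_eq ?_)
      simp
    · refine le_of_eq ?_
      rw [← Finset.sum_subset (Finset.range_subset_range.mpr h)]
      · simp
      · intro j _ hj
        rw [Finset.mem_range, not_lt] at hj
        rw [Nat.choose_eq_zero_of_lt (by omega)]
        simp
  have h3 : (t + 1) ^ N ≤ Real.exp (b / 2 * N) := by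
    calc (t + 1) ^ N ≤ Real.exp t ^ N := by
          gcongr
          exact Real.add_one_le_exp t
      _ = Real.exp (N * t) := (Real.exp_nat_mul _ _).symm
      _ ≤ _ := Real.exp_le_exp.mpr (by nlinarith [Nat.cast_nonneg (α := ℝ) N])
  push_cast
  calc ∑ j ∈ Finset.range M, (N.choose j : ℝ)
      ≤ ∑ j ∈ Finset.range M, Real.exp (b / 2 * N) * (t ^ j * N.choose j) := Finset.sum_le_sum h1
    _ = Real.exp (b / 2 * N) * ∑ j ∈ Finset.range M, t ^ j * (N.choose j : ℝ) := by
        rw [Finset.mul_sum]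
    _ ≤ Real.exp (b / 2 * N) * Real.exp (b / 2 * N) := by
        gcongr
        exact h2.trans h3
    _ = Real.exp (b * N) := by rw [← Real.exp_add]; congr 1; ring

/-- Either a proportional index set is shattered or subexponentially many patterns suffice. -/
theorem exists_shatters_or_patterns {b : ℝ} (hb : 0 < b) :
    ∃ c : ℝ, 0 < c ∧ ∀ {P ι : Type*} [DecidableEq ι] (A B : ι → Set P),
      (∀ i, Disjoint (A i) (B i)) → ∀ I : Finset ι,
        (∃ J ⊆ I, J.Nonempty ∧ c * I.card ≤ J.card ∧ Shatters A B Set.univ J) ∨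
        ∃ F : Finset (ι → Bool), (F.card : ℝ) ≤ Real.exp (b * I.card) ∧
          ∀ p, ∃ σ ∈ F, ∀ i ∈ I, (σ i = true → p ∉ B i) ∧ (σ i = false → p ∉ A i) := by
  -- The estimate is used at two scales. If no set of size at least `c₂ N` is shattered, there are
  -- at most `2 ^ (c₁ N)` shattered sets, which allows `M = ⌊c₁ N⌋ + 1` in the pattern lemma; `c₁`
  -- makes the resulting number of patterns at most `exp (b N)`.
  obtain ⟨c₁, hc₁, h₁⟩ := sum_choose_le_exp hb
  obtain ⟨c₂, hc₂, h₂⟩ := sum_choose_le_exp (b := c₁ * Real.log 2)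
    (mul_pos hc₁ (Real.log_pos one_lt_two))
  refine ⟨c₂, hc₂, fun {P ι} _ A B hAB I => ?_⟩
  rcases I.eq_empty_or_nonempty with rfl | hI
  · exact Or.inr ⟨{fun _ => true}, by simp, by simp⟩
  by_cases hJ : ∃ J ⊆ I, c₂ * I.card ≤ J.card ∧ Shatters A B Set.univ J
  · obtain ⟨J, hJI, hcard, hJ⟩ := hJ
    have hpos : (0 : ℝ) < J.card :=
      (mul_pos hc₂ (by exact_mod_cast hI.card_pos)).trans_le hcard
    exact Or.inl ⟨J, hJI, Finset.card_pos.mp (by exact_mod_cast hpos), hcard, hJ⟩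
  right
  push Not at hJ
  set N := I.card with hN
  set m := ⌈c₂ * N⌉₊ with hm
  have hsub : shattered A B Set.univ I ⊆ (Finset.range m).biUnion fun j => I.powersetCard j := by
    intro J h
    rw [mem_shattered] at h
    simp only [Finset.mem_biUnion, Finset.mem_range, Finset.mem_powersetCard]
    refine ⟨J.card, ?_, h.1, rfl⟩
    rw [hm, Nat.lt_ceil]
    by_contra hcon
    exact hJ J h.1 (not_lt.mp hcon) h.2
  have hcard : ((shattered A B Set.univ I).card : ℝ) ≤ Real.exp (c₁ * Real.log 2 * N) := by
    refine le_trans ?_ (h₂ N m (Nat.ceil_lt_add_one (by positivity)).le)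
    have := (Finset.card_le_card hsub).trans Finset.card_biUnion_le
    simp only [Finset.card_powersetCard] at this
    exact_mod_cast this
  obtain ⟨F, hF, hF'⟩ := exists_patterns_of_card_shattered_lt hAB I Set.univ (⌊c₁ * N⌋₊ + 1) (by
    have h3 : Real.exp (c₁ * Real.log 2 * N) < 2 ^ (⌊c₁ * N⌋₊ + 1) := by
      rw [show (2 : ℝ) ^ (⌊c₁ * N⌋₊ + 1) = Real.exp (((⌊c₁ * N⌋₊ + 1 : ℕ) : ℝ) * Real.log 2) by
        rw [Real.exp_nat_mul, Real.exp_log two_pos]]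
      rw [Real.exp_lt_exp]
      have := Nat.lt_floor_add_one (c₁ * N)
      have hl := Real.log_pos one_lt_two
      push_cast
      nlinarith
    exact_mod_cast hcard.trans_lt h3)
  refine ⟨F, ?_, fun p => hF' p (Set.mem_univ p)⟩
  refine le_trans (by exact_mod_cast hF) (h₁ N (⌊c₁ * N⌋₊ + 1) ?_)
  push_cast
  linarith [Nat.floor_le (show 0 ≤ c₁ * N by positivity)]

/-- If every choice of signs has a large sum against one of finitely many bounded vectors, then
there are exponentially many vectors. -/
theorem exp_le_card_of_sign_sums {𝕜 τ ι : Type*} [RCLike 𝕜] [Fintype ι] (s : Finset τ)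
    (a : τ → ι → 𝕜) {A θ : ℝ} (hA : 0 < A) (hθ : 0 < θ) (ha : ∀ t ∈ s, ∀ i, ‖a t i‖ ≤ A)
    (h : ∀ σ : ι → Bool, ∃ t ∈ s,
      θ * Fintype.card ι ≤ ‖∑ i, (if σ i then (1 : 𝕜) else -1) * a t i‖) :
    Real.exp (θ ^ 2 / (8 * A ^ 2) * Fintype.card ι) / 4 ≤ s.card := by
  classical
  set m : ℝ := (Fintype.card ι : ℝ) with hm
  have hm0 : 0 ≤ m := Nat.cast_nonneg _
  set l : ℝ := θ / (2 * A ^ 2) with hl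
  have hl0 : 0 < l := by positivity
  let sg : Bool → ℝ := fun b => if b then 1 else -1
  have hoeff : ∀ b : ι → ℝ, (∀ i, |b i| ≤ A) →
      ∑ σ : ι → Bool, Real.exp (l * ∑ i, sg (σ i) * b i) ≤
        2 ^ Fintype.card ι * Real.exp (l ^ 2 * A ^ 2 / 2 * m) := by
    intro b hb
    have h1 : ∀ σ : ι → Bool, Real.exp (l * ∑ i, sg (σ i) * b i) =
        ∏ i, Real.exp (l * (sg (σ i) * b i)) := fun σ => by
      rw [Finset.mul_sum, Real.exp_sum]
    simp_rw [h1]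
    have h2 := Finset.prod_univ_sum (fun _ : ι => (Finset.univ : Finset Bool))
      (fun i c => Real.exp (l * (sg c * b i)))
    rw [Fintype.piFinset_univ] at h2
    rw [← h2]
    calc ∏ i, ∑ c : Bool, Real.exp (l * (sg c * b i))
        ≤ ∏ _i : ι, (2 * Real.exp (l ^ 2 * A ^ 2 / 2)) := by
          refine Finset.prod_le_prod (fun i _ => Finset.sum_nonneg fun _ _ => (Real.exp_pos _).le)
            fun i _ => ?_
          have h3 : ∑ c : Bool, Real.exp (l * (sg c * b i)) = 2 * Real.cosh (l * b i) := by
            rw [Fintype.sum_bool, Real.cosh_eq]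
            simp [sg]
            ring
          rw [h3]
          gcongr
          refine (Real.cosh_le_exp_half_sq _).trans (Real.exp_le_exp.mpr ?_)
          rw [mul_pow]
          have : b i ^ 2 ≤ A ^ 2 := sq_le_sq' (by linarith [abs_le.mp (hb i)]) (abs_le.mp (hb i)).2
          gcongr
      _ = _ := by
          rw [Finset.prod_const, mul_pow, ← Real.exp_nat_mul, Finset.card_univ, mul_comm m]
  have hsum : ∀ (σ : ι → Bool) (t : τ), ∑ i, (if σ i then (1 : 𝕜) else -1) * a t i =
      ((∑ i, sg (σ i) * RCLike.re (a t i) : ℝ) : 𝕜) +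
        ((∑ i, sg (σ i) * RCLike.im (a t i) : ℝ) : 𝕜) * RCLike.I := by
    intro σ t
    push_cast
    rw [Finset.sum_mul, ← Finset.sum_add_distrib]
    refine Finset.sum_congr rfl fun i _ => ?_
    have hre := RCLike.re_add_im (a t i)
    cases σ i
    · simp only [sg, Bool.false_eq_true, if_false]
      push_cast
      linear_combination hre
    · simp only [sg, if_true]
      push_cast
      linear_combination -hre
  let E : (ι → ℝ) → (ι → Bool) → ℝ := fun b σ => Real.exp (l * ∑ i, sg (σ i) * b i)
  let R : τ → ι → ℝ := fun t i => RCLike.re (a t i)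
  let J : τ → ι → ℝ := fun t i => RCLike.im (a t i)
  have hE0 : ∀ b σ, 0 < E b σ := fun b σ => Real.exp_pos _
  have hneg : ∀ (b : ι → ℝ) (σ : ι → Bool), ∑ i, sg (σ i) * (-b) i = -∑ i, sg (σ i) * b i := by
    intro b σ; simp
  -- A large scalar sum has real or imaginary part at least half as large, with one of two signs.
  -- The four exponentials cover these cases and account for the factor `4` in the conclusion.
  have low : ∀ σ : ι → Bool, Real.exp (l * (θ / 2 * m)) ≤
      ∑ t ∈ s, (E (R t) σ + E (-R t) σ + E (J t) σ + E (-J t) σ) := by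
    intro σ
    obtain ⟨t, hts, ht⟩ := h σ
    refine le_trans ?_ (Finset.single_le_sum (f := fun t =>
      E (R t) σ + E (-R t) σ + E (J t) σ + E (-J t) σ)
      (fun t _ => by have := hE0 (R t) σ; have := hE0 (-R t) σ; have := hE0 (J t) σ
                     have := hE0 (-J t) σ; linarith) hts)
    have hIle : ‖(RCLike.I : 𝕜)‖ ≤ 1 := by
      rw [RCLike.norm_I]; split_ifs <;> norm_num
    have h2 : θ * m ≤ |∑ i, sg (σ i) * R t i| + |∑ i, sg (σ i) * J t i| := by
      rw [hsum] at ht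
      refine ht.trans ((norm_add_le _ _).trans ?_)
      rw [norm_mul, RCLike.norm_ofReal, RCLike.norm_ofReal]
      exact add_le_add le_rfl (mul_le_of_le_one_right (abs_nonneg _) hIle)
    have hp1 := hE0 (R t) σ
    have hp2 := hE0 (-R t) σ
    have hp3 := hE0 (J t) σ
    have hp4 := hE0 (-J t) σ
    have big : ∀ b : ι → ℝ, θ / 2 * m ≤ |∑ i, sg (σ i) * b i| →
        Real.exp (l * (θ / 2 * m)) ≤ E b σ + E (-b) σ := by
      intro b hb
      have q1 := hE0 b σ
      have q2 := hE0 (-b) σ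
      rcases le_abs.mp hb with h3 | h3
      · have : Real.exp (l * (θ / 2 * m)) ≤ E b σ := by
          refine Real.exp_le_exp.mpr ?_
          gcongr
        linarith
      · have : Real.exp (l * (θ / 2 * m)) ≤ E (-b) σ := by
          refine Real.exp_le_exp.mpr ?_
          rw [hneg]
          gcongr
        linarith
    rcases le_total (θ / 2 * m) |∑ i, sg (σ i) * R t i| with h3 | h3
    · linarith [big (R t) h3]
    · linarith [big (J t) (by linarith)]
  have up : ∑ σ : ι → Bool, ∑ t ∈ s, (E (R t) σ + E (-R t) σ + E (J t) σ + E (-J t) σ) ≤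
      s.card * (4 * (2 ^ Fintype.card ι * Real.exp (l ^ 2 * A ^ 2 / 2 * m))) := by
    rw [Finset.sum_comm, ← nsmul_eq_mul]
    refine Finset.sum_le_card_nsmul _ _ _ fun t ht => ?_
    have hR : ∀ i, |R t i| ≤ A := fun i => (RCLike.abs_re_le_norm _).trans (ha t ht i)
    have hJ : ∀ i, |J t i| ≤ A := fun i => (RCLike.abs_im_le_norm _).trans (ha t ht i)
    simp only [Finset.sum_add_distrib]
    have e1 := hoeff (R t) hR
    have e2 := hoeff (-R t) (fun i => by simpa using hR i)
    have e3 := hoeff (J t) hJ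
    have e4 := hoeff (-J t) (fun i => by simpa using hJ i)
    simp only [E]
    linarith
  have low' : 2 ^ Fintype.card ι * Real.exp (l * (θ / 2 * m)) ≤
      ∑ σ : ι → Bool, ∑ t ∈ s, (E (R t) σ + E (-R t) σ + E (J t) σ + E (-J t) σ) := by
    have := Finset.card_nsmul_le_sum (Finset.univ : Finset (ι → Bool)) _ _ fun σ _ => low σ
    simpa [nsmul_eq_mul] using this
  have hfin := low'.trans up
  have h2m : (0 : ℝ) < 2 ^ Fintype.card ι := by positivity
  have hfin' : Real.exp (l * (θ / 2 * m)) ≤ s.card * 4 * Real.exp (l ^ 2 * A ^ 2 / 2 * m) := by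
    refine le_of_mul_le_mul_left (hfin.trans (le_of_eq ?_)) h2m
    ring
  have hexp : θ ^ 2 / (8 * A ^ 2) * m = l * (θ / 2 * m) - l ^ 2 * A ^ 2 / 2 * m := by
    rw [hl]; field_simp; ring
  rw [hexp, Real.exp_sub, div_div, div_le_iff₀ (by positivity)]
  linarith

/-! ### Sets of exact density with finite subsets in a hereditary translation invariant family -/

section Density

variable {F : Set (Finset ℕ)}

open Classical in
/-- The largest cardinality of a member of `F` contained in `{0, …, n - 1}`. -/
def maxCard (F : Set (Finset ℕ)) (n : ℕ) : ℕ :=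
  ((Finset.range n).powerset.filter (· ∈ F)).sup Finset.card

theorem card_le_maxCard {J : Finset ℕ} {n : ℕ} (hJ : J ∈ F) (hn : J ⊆ Finset.range n) :
    J.card ≤ maxCard F n := by
  classical
  exact Finset.le_sup (f := Finset.card)
    (Finset.mem_filter.mpr ⟨Finset.mem_powerset.mpr hn, hJ⟩)

theorem maxCard_le_iff {n m : ℕ} :
    maxCard F n ≤ m ↔ ∀ J ∈ F, J ⊆ Finset.range n → J.card ≤ m := by
  simp only [maxCard, Finset.sup_le_iff, Finset.mem_filter, Finset.mem_powerset]
  exact ⟨fun h J hJ hn => h J ⟨hn, hJ⟩, fun h J hJ => h J hJ.2 hJ.1⟩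

theorem exists_shift_of_mem (her : ∀ J ∈ F, ∀ J' ⊆ J, J' ∈ F)
    (tr : ∀ (J : Finset ℕ) (a : ℕ), J.map (addRightEmbedding a) ∈ F → J ∈ F)
    {J : Finset ℕ} (hJ : J ∈ F) (n : ℕ) :
    ∃ J' ∈ F, ∀ i, i ∈ J' ↔ i + n ∈ J := by
  refine ⟨(J.preimage (· + n) (add_left_injective n).injOn), tr _ n (her J hJ _ ?_), by simp⟩
  intro i hi
  obtain ⟨j, hj, rfl⟩ := Finset.mem_map.mp hi
  simpa using hj

theorem card_le_card_add_of_shift {J J' : Finset ℕ} {n M : ℕ} (hM : J ⊆ Finset.range (n + M))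
    (hJ' : ∀ i, i ∈ J' ↔ i + n ∈ J) :
    J' ⊆ Finset.range M ∧ J.card ≤ (J.filter (· < n)).card + J'.card := by
  constructor
  · intro i hi
    have := Finset.mem_range.mp (hM ((hJ' i).mp hi))
    exact Finset.mem_range.mpr (by omega)
  · rw [← Finset.card_filter_add_card_filter_not (s := J) (· < n)]
    refine Nat.add_le_add_left ?_ _
    rw [← Finset.card_map (addRightEmbedding n) (s := J')]
    refine Finset.card_le_card fun i hi => ?_
    obtain ⟨hi, hin⟩ := Finset.mem_filter.mp hi
    refine Finset.mem_map.mpr ⟨i - n, (hJ' _).mpr ?_, ?_⟩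
    · rwa [Nat.sub_add_cancel (not_lt.mp hin)]
    · simpa using Nat.sub_add_cancel (not_lt.mp hin)

/-- A member inside `{0, …, n+m-1}` is cut at `n`: its beginning lies in the family by heredity, its
tail by heredity and translation. -/
theorem subadditive_maxCard (her : ∀ J ∈ F, ∀ J' ⊆ J, J' ∈ F)
    (tr : ∀ (J : Finset ℕ) (a : ℕ), J.map (addRightEmbedding a) ∈ F → J ∈ F) :
    Subadditive fun n => (maxCard F n : ℝ) := by
  intro n m
  rw [← Nat.cast_add, Nat.cast_le, maxCard_le_iff]
  intro J hJ hJn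
  obtain ⟨J', hJ', h⟩ := exists_shift_of_mem her tr hJ n
  obtain ⟨h1, h2⟩ := card_le_card_add_of_shift hJn h
  refine h2.trans (add_le_add (card_le_maxCard (her J hJ _ (Finset.filter_subset _ _)) ?_)
    (card_le_maxCard hJ' h1))
  intro i hi
  exact Finset.mem_range.mpr (Finset.mem_filter.mp hi).2

/-- A member of `F` all of whose initial segments up to length `N` are dense. -/
theorem exists_dense_initial_segments (her : ∀ J ∈ F, ∀ J' ⊆ J, J' ∈ F)
    (tr : ∀ (J : Finset ℕ) (a : ℕ), J.map (addRightEmbedding a) ∈ F → J ∈ F) {D ε : ℝ}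
    (hD : ∀ n : ℕ, D * n ≤ maxCard F n) (hε : 0 < ε) (hεD : ε ≤ D) (N : ℕ) :
    ∃ J ∈ F, ∀ n ≤ N, (D - ε) * n ≤ (J.filter (· < n)).card := by
  -- Otherwise every member has a sparse initial segment of length at most `N`. Peeling such
  -- segments off repeatedly gives cardinality at most `(D - ε) M + N` within `{0, …, M-1}`, which
  -- contradicts `hD` for large `M`.
  by_contra! hcon
  have key : ∀ M : ℕ, ∀ J ∈ F, J ⊆ Finset.range M → (J.card : ℝ) ≤ (D - ε) * M + N := by
    intro M
    induction M using Nat.strong_induction_on with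
    | _ M ih =>
      intro J hJ hJM
      rcases le_total M N with hMN | hMN
      · have h1 : J.card ≤ M := by simpa using Finset.card_le_card hJM
        have h2 : (J.card : ℝ) ≤ N := by exact_mod_cast h1.trans hMN
        have : 0 ≤ (D - ε) * M := mul_nonneg (by linarith) (Nat.cast_nonneg _)
        linarith
      · obtain ⟨n, hn, hlt⟩ := hcon J hJ
        have hn0 : n ≠ 0 := by rintro rfl; simp at hlt
        obtain ⟨J', hJ', h⟩ := exists_shift_of_mem her tr hJ n
        obtain ⟨k, rfl⟩ := Nat.exists_eq_add_of_le (hn.trans hMN)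
        obtain ⟨h1, h2⟩ := card_le_card_add_of_shift hJM h
        have h3 := ih k (by omega) J' hJ' h1
        have h4 : (J.card : ℝ) ≤ (J.filter (· < n)).card + J'.card := by exact_mod_cast h2
        push_cast
        linarith
  obtain ⟨M, hM⟩ := exists_nat_gt (((N : ℝ) + 1) / ε)
  rw [div_lt_iff₀ hε] at hM
  have h1 : (maxCard F M : ℝ) ≤ ⌊(D - ε) * M + N⌋₊ := by
    rw [Nat.cast_le, maxCard_le_iff]
    exact fun J hJ hJM => Nat.le_floor (key M J hJ hJM)
  have h2 : 0 ≤ (D - ε) * M + N :=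
    add_nonneg (mul_nonneg (by linarith) (Nat.cast_nonneg _)) (Nat.cast_nonneg _)
  have h3 := Nat.floor_le h2
  have h4 := hD M
  linarith

-- The density is the Fekete limit `D` of `maxCard F n / n`. Since `D` is also the infimum, members
-- with initial segments of density nearly `D` exist; a limit of them has initial densities at least
-- `D`, and `maxCard` bounds these densities from above.
open Classical in
theorem exists_set_of_density (her : ∀ J ∈ F, ∀ J' ⊆ J, J' ∈ F)
    (tr : ∀ (J : Finset ℕ) (a : ℕ), J.map (addRightEmbedding a) ∈ F → J ∈ F) {d : ℝ} (hd : 0 < d)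
    (hF : ∃ᶠ n : ℕ in atTop, ∃ J ∈ F, J ⊆ Finset.range n ∧ d * n ≤ J.card) :
    ∃ (I : Set ℕ) (D : ℝ), 0 < D ∧
      Tendsto (fun n : ℕ => (((Finset.range n).filter (· ∈ I)).card : ℝ) / n) atTop (𝓝 D) ∧
      ∀ J : Finset ℕ, (J : Set ℕ) ⊆ I → J ∈ F := by
  have hsub := subadditive_maxCard her tr
  have hbdd : BddBelow (Set.range fun n : ℕ => (maxCard F n : ℝ) / n) :=
    ⟨0, by rintro _ ⟨n, rfl⟩; positivity⟩
  have hlim := hsub.tendsto_lim hbdd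
  set D := hsub.lim with hDdef
  have hdD : d ≤ D := by
    refine ge_of_tendsto_of_frequently hlim ?_
    refine (hF.and_eventually (eventually_gt_atTop 0)).mono ?_
    rintro n ⟨⟨J, hJ, hJn, hc⟩, hn⟩
    rw [le_div_iff₀ (by exact_mod_cast hn)]
    exact hc.trans (by exact_mod_cast card_le_maxCard hJ hJn)
  have hD0 : 0 < D := hd.trans_le hdD
  have hDle : ∀ n : ℕ, D * n ≤ maxCard F n := by
    intro n
    rcases Nat.eq_zero_or_pos n with rfl | hn
    · simp
    · have := hsub.lim_le_div hbdd hn.ne'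
      rwa [le_div_iff₀ (by exact_mod_cast hn)] at this
  choose J hJF hJ using fun N : ℕ => exists_dense_initial_segments her tr hDle
    (ε := D / (N + 1)) (by positivity)
    (div_le_self hD0.le (by linarith [Nat.cast_nonneg (α := ℝ) N])) N
  -- The ultrafilter limit of the sets `J N`: each initial segment of `I` agrees with that of `J N`
  -- for almost all `N`, so both membership of finite subsets in `F` and the density bounds pass to
  -- `I`.
  let I : Set ℕ := {i | ∀ᶠ N in (hyperfilter ℕ : Filter ℕ), i ∈ J N}
  have hI : ∀ n : ℕ, ∀ᶠ N in (hyperfilter ℕ : Filter ℕ), ∀ i < n, (i ∈ I ↔ i ∈ J N) := by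
    intro n
    have : ∀ i ∈ Finset.range n, ∀ᶠ N in (hyperfilter ℕ : Filter ℕ), (i ∈ I ↔ i ∈ J N) := by
      intro i _
      by_cases hi : i ∈ I
      · exact (show ∀ᶠ N in (hyperfilter ℕ : Filter ℕ), i ∈ J N from hi).mono fun N h => by
          simp [hi, h]
      · exact (Ultrafilter.eventually_not.mpr
          (show ¬ ∀ᶠ N in (hyperfilter ℕ : Filter ℕ), i ∈ J N from hi)).mono fun N h => by
          simp [hi, h]
    have h2 := (eventually_all_finset (Finset.range n)).mpr this
    simpa using h2
  have hIF : ∀ J' : Finset ℕ, (J' : Set ℕ) ⊆ I → J' ∈ F := by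
    intro J' hJ'
    obtain ⟨N, hN⟩ := (hI (J'.sup id + 1)).exists
    refine her _ (hJF N) _ fun i hi => (hN i ?_).mp (hJ' hi)
    exact Nat.lt_succ_of_le (Finset.le_sup (f := id) hi)
  have hlow : ∀ n : ℕ, D * n ≤ (((Finset.range n).filter (· ∈ I)).card : ℝ) := by
    intro n
    have hge : ∀ᶠ N : ℕ in (hyperfilter ℕ : Filter ℕ), (D - D / (N + 1)) * n ≤
        (((Finset.range n).filter (· ∈ I)).card : ℝ) := by
      have hlarge : ∀ᶠ N in (hyperfilter ℕ : Filter ℕ), n ≤ N :=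
        (Nat.hyperfilter_le_atTop) (eventually_ge_atTop n)
      filter_upwards [hI n, hlarge] with N h1 h2
      refine (hJ N n h2).trans ?_
      rw [Nat.cast_le]
      refine Finset.card_le_card fun i hi => ?_
      rw [Finset.mem_filter] at hi ⊢
      exact ⟨Finset.mem_range.mpr hi.2, (h1 i hi.2).mpr hi.1⟩
    have ht : Tendsto (fun N : ℕ => (D - D / ((N : ℝ) + 1)) * n) (hyperfilter ℕ : Filter ℕ)
        (𝓝 ((D - 0) * n)) := by
      refine Tendsto.mul_const _ (tendsto_const_nhds.sub ?_)
      have h0 := (tendsto_one_div_add_atTop_nhds_zero_nat (𝕜 := ℝ)).const_mul D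
      simp only [mul_one_div, mul_zero] at h0
      exact h0.mono_left Nat.hyperfilter_le_atTop
    rw [sub_zero] at ht
    exact le_of_tendsto ht hge
  refine ⟨I, D, hD0, ?_, hIF⟩
  refine tendsto_of_tendsto_of_tendsto_of_le_of_le' tendsto_const_nhds hlim ?_ ?_
  · filter_upwards [eventually_gt_atTop 0] with n hn
    rw [le_div_iff₀ (by exact_mod_cast hn)]
    exact hlow n
  · refine Eventually.of_forall fun n => ?_
    have : (((Finset.range n).filter (· ∈ I)).card : ℝ) ≤ maxCard F n := by
      rw [Nat.cast_le]
      refine card_le_maxCard (hIF _ fun i hi => ?_) (Finset.filter_subset _ _)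
      exact (Finset.mem_filter.mp (by exact_mod_cast hi)).2
    exact div_le_div_of_nonneg_right this (Nat.cast_nonneg _)

end Density

/-! ### Lower `ℓ₁`-estimates -/

section EllOneLower

variable (𝕜 : Type*) {X : Type*} [RCLike 𝕜] [NormedAddCommGroup X] [NormedSpace 𝕜 X]

/-- The family `y` satisfies a lower `ℓ₁`-estimate with constant `r` on the finite set `J`. -/
def EllOneLower {ι : Type*} (y : ι → X) (r : ℝ) (J : Finset ι) : Prop :=
  ∀ c : ι → 𝕜, r * ∑ i ∈ J, ‖c i‖ ≤ ‖∑ i ∈ J, c i • y i‖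

variable {𝕜}

theorem EllOneLower.mono {ι : Type*} {y : ι → X} {r : ℝ} {J J' : Finset ι}
    (h : EllOneLower 𝕜 y r J) (hJ : J' ⊆ J) : EllOneLower 𝕜 y r J' := by
  classical
  intro c
  have h1 := h fun i => if i ∈ J' then c i else 0
  have e1 : ∑ i ∈ J, ‖if i ∈ J' then c i else 0‖ = ∑ i ∈ J', ‖c i‖ := by
    rw [← Finset.sum_subset hJ]
    · exact Finset.sum_congr rfl fun i hi => by rw [if_pos hi]
    · intro i _ hi
      rw [if_neg hi, norm_zero]
  have e2 : ∑ i ∈ J, (if i ∈ J' then c i else 0) • y i = ∑ i ∈ J', c i • y i := by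
    rw [← Finset.sum_subset hJ]
    · exact Finset.sum_congr rfl fun i hi => by rw [if_pos hi]
    · intro i _ hi
      rw [if_neg hi, zero_smul]
  rwa [e1, e2] at h1

theorem EllOneLower.comp_linearIsometry {ι : Type*} {y : ι → X} {r : ℝ} {J : Finset ι}
    (β : X →ₗᵢ[𝕜] X) : EllOneLower 𝕜 (fun i => β (y i)) r J ↔ EllOneLower 𝕜 y r J := by
  refine forall_congr' fun c => ?_
  rw [← β.norm_map (∑ i ∈ J, c i • y i)]
  simp

theorem EllOneLower.of_map {ι κ : Type*} {y : κ → X} {r : ℝ} {J : Finset ι} (e : ι ↪ κ)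
    (h : EllOneLower 𝕜 y r (J.map e)) : EllOneLower 𝕜 (y ∘ e) r J := by
  intro c
  have h1 := h (Function.extend e c 0)
  simpa [Finset.sum_map, e.injective.extend_apply] using h1

theorem EllOneLower.injective {ι : Type*} {y : ι → X} {r : ℝ} (hr : 0 < r)
    (h : ∀ J : Finset ι, EllOneLower 𝕜 y r J) : Function.Injective y := by
  classical
  intro i j hij
  by_contra hne
  have h1 := h {i, j} fun k => if k = i then 1 else -1
  rw [Finset.sum_pair hne, Finset.sum_pair hne] at h1
  simp [Ne.symm hne, hij] at h1
  linarith

theorem summable_smul_of_bounded [CompleteSpace X] {ι : Type*} {y : ι → X} {A : ℝ}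
    (hA : ∀ i, ‖y i‖ ≤ A) (f : lp (fun _ : ι => 𝕜) 1) : Summable fun i => f i • y i := by
  have hs : Summable fun i => ‖f i‖ := by simpa using f.2.summable (by simp)
  refine Summable.of_norm_bounded (hs.mul_right A) fun i => ?_
  rw [norm_smul]
  gcongr
  exact hA i

/-- The map `ℓ₁ → X` determined by a bounded family. -/
def ellOneMap [CompleteSpace X] {ι : Type*} (y : ι → X) {A : ℝ} (hA : ∀ i, ‖y i‖ ≤ A) :
    lp (fun _ : ι => 𝕜) 1 →L[𝕜] X :=
  LinearMap.mkContinuous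
    { toFun := fun f => ∑' i, f i • y i
      map_add' := fun f g => by
        rw [← (summable_smul_of_bounded hA f).tsum_add (summable_smul_of_bounded hA g)]
        simp [add_smul]
      map_smul' := fun c f => by
        rw [RingHom.id_apply, ← (summable_smul_of_bounded hA f).tsum_const_smul c]
        simp [mul_smul] } A (fun f => by
    have hn : HasSum (fun i => ‖f i‖) ‖f‖ := by
      simpa using lp.hasSum_norm (p := 1) (by simp) f
    refine tsum_of_norm_bounded (hn.mul_left A) fun i => ?_
    rw [norm_smul, mul_comm]
    gcongr
    exact hA i)

theorem ellOneMap_apply [CompleteSpace X] {ι : Type*} (y : ι → X) {A : ℝ} (hA : ∀ i, ‖y i‖ ≤ A)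
    (f : lp (fun _ : ι => 𝕜) 1) : ellOneMap y hA f = ∑' i, f i • y i := rfl

theorem norm_ellOneMap_le [CompleteSpace X] {ι : Type*} (y : ι → X) {A : ℝ} (hA0 : 0 ≤ A)
    (hA : ∀ i, ‖y i‖ ≤ A) : ‖ellOneMap (𝕜 := 𝕜) y hA‖ ≤ A :=
  LinearMap.mkContinuous_norm_le _ hA0 _

theorem ellOneMap_lower [CompleteSpace X] {ι : Type*} (y : ι → X) {A r : ℝ}
    (hA : ∀ i, ‖y i‖ ≤ A) (h : ∀ J : Finset ι, EllOneLower 𝕜 y r J)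
    (f : lp (fun _ : ι => 𝕜) 1) : r * ‖f‖ ≤ ‖ellOneMap y hA f‖ := by
  have hn : HasSum (fun i => ‖f i‖) ‖f‖ := by
    simpa using lp.hasSum_norm (p := 1) (by simp) f
  refine le_of_tendsto_of_tendsto (hn.const_mul r)
    (summable_smul_of_bounded hA f).hasSum.norm (Eventually.of_forall fun J => h J f)

open Classical in
theorem ellOneMap_single [CompleteSpace X] {ι : Type*} (y : ι → X) {A : ℝ} (hA : ∀ i, ‖y i‖ ≤ A)
    (i : ι) : ellOneMap (𝕜 := 𝕜) y hA (lp.single 1 i (1 : 𝕜)) = y i := by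
  rw [ellOneMap_apply, tsum_eq_single i]
  · simp
  · intro j hj
    simp [hj]

open Classical in
/-- A bounded family with a lower `ℓ₁`-estimate is equivalent to the standard basis. -/
theorem exists_equiv_of_ellOneLower [CompleteSpace X] {ι : Type*} (y : ι → X) {A r : ℝ}
    (hr : 0 < r) (hA0 : 0 ≤ A) (hA : ∀ i, ‖y i‖ ≤ A) (h : ∀ J : Finset ι, EllOneLower 𝕜 y r J)
    {S : Set X} (hS : Set.range y = S) :
    ∃ γ : lp (fun _ : ι => 𝕜) 1 ≃L[𝕜] (Submodule.span 𝕜 S).topologicalClosure,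
      MapsBasisOnto 𝕜 ι S γ ∧
      ‖(γ : lp (fun _ : ι => 𝕜) 1 →L[𝕜] (Submodule.span 𝕜 S).topologicalClosure)‖ ≤ A ∧
      ‖(γ.symm : (Submodule.span 𝕜 S).topologicalClosure →L[𝕜] lp (fun _ : ι => 𝕜) 1)‖ ≤ 1 / r := by
  subst hS
  set T := ellOneMap (𝕜 := 𝕜) y hA with hT
  set V := (Submodule.span 𝕜 (Set.range y)).topologicalClosure with hV
  have hlow : ∀ f, r * ‖f‖ ≤ ‖T f‖ := ellOneMap_lower y hA h
  have hup : ∀ f, ‖T f‖ ≤ A * ‖f‖ := fun f => T.le_of_opNorm_le (norm_ellOneMap_le y hA0 hA) f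
  -- Being bounded below makes the range of `T` closed, hence equal to the closed span.
  have hanti : AntilipschitzWith (Real.toNNReal (1 / r)) T := by
    refine AddMonoidHomClass.antilipschitz_of_bound T fun f => ?_
    rw [Real.coe_toNNReal _ (by positivity), one_div, inv_mul_eq_div, le_div_iff₀ hr, mul_comm]
    exact hlow f
  have hclosed : IsClosed (Set.range T) := hanti.isClosed_range T.uniformContinuous
  have hmem : ∀ f, T f ∈ V := by
    intro f
    refine (Submodule.isClosed_topologicalClosure _).mem_of_tendsto
      (summable_smul_of_bounded hA f).hasSum (Eventually.of_forall fun J => ?_)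
    refine Submodule.le_topologicalClosure _ (Submodule.sum_mem _ fun i _ => ?_)
    exact Submodule.smul_mem _ _ (Submodule.subset_span ⟨i, rfl⟩)
  have hsurj : ∀ v ∈ V, ∃ f, T f = v := by
    have hle : V ≤ LinearMap.range (T : lp (fun _ : ι => 𝕜) 1 →ₗ[𝕜] X) := by
      refine Submodule.topologicalClosure_minimal _ (Submodule.span_le.mpr ?_) ?_
      · rintro _ ⟨i, rfl⟩
        exact ⟨lp.single 1 i (1 : 𝕜), ellOneMap_single y hA i⟩
      · rw [LinearMap.coe_range]
        exact hclosed
    intro v hv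
    exact hle hv
  let e : lp (fun _ : ι => 𝕜) 1 ≃ₗ[𝕜] V :=
    LinearEquiv.ofBijective (LinearMap.codRestrict V (T : lp (fun _ : ι => 𝕜) 1 →ₗ[𝕜] X) hmem) (by
      constructor
      · intro f g hfg
        exact hanti.injective (congrArg Subtype.val hfg)
      · rintro ⟨v, hv⟩
        obtain ⟨f, hf⟩ := hsurj v hv
        exact ⟨f, Subtype.ext hf⟩)
  have he : ∀ f, (e f : X) = T f := fun f => rfl
  have h1 : ∀ f, ‖e f‖ ≤ A * ‖f‖ := fun f => hup f
  have h2 : ∀ v, ‖e.symm v‖ ≤ 1 / r * ‖v‖ := by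
    intro v
    have := hlow (e.symm v)
    rw [← he, e.apply_symm_apply] at this
    rw [one_div, inv_mul_eq_div, le_div_iff₀ hr, mul_comm]
    exact this
  refine ⟨e.toContinuousLinearEquivOfBounds A (1 / r) h1 h2, ?_, ?_, ?_⟩
  · have hs : ∀ i, ((e.toContinuousLinearEquivOfBounds A (1 / r) h1 h2
        (lp.single 1 i (1 : 𝕜)) : V) : X) = y i := fun i => ellOneMap_single y hA i
    refine ⟨fun i _ => ⟨i, (hs i).symm⟩, fun i _ j _ hij => ?_, ?_⟩
    · exact EllOneLower.injective hr h (by simpa only [hs] using hij)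
    · rintro _ ⟨i, rfl⟩
      exact ⟨i, Set.mem_univ i, hs i⟩
  · exact ContinuousLinearMap.opNorm_le_bound _ hA0 h1
  · exact ContinuousLinearMap.opNorm_le_bound _ (by positivity) h2

theorem norm_pos_of_mapsBasisOnto {ι : Type*} {S : Set X}
    {γ : lp (fun _ : ι => 𝕜) 1 ≃L[𝕜] (Submodule.span 𝕜 S).topologicalClosure}
    (hγ : MapsBasisOnto 𝕜 ι S γ) {v : X} (hv : v ∈ S) : 0 < ‖v‖ := by
  classical
  obtain ⟨i, -, rfl⟩ := hγ.surjOn hv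
  rw [norm_pos_iff]
  intro h0
  have h1 := congrArg norm (γ.map_eq_zero_iff.mp (Submodule.coe_eq_zero.mp h0))
  rw [lp.norm_single (by simp)] at h1
  simp at h1

theorem norm_le_of_mapsBasisOnto {ι : Type*} {S : Set X}
    {γ : lp (fun _ : ι => 𝕜) 1 ≃L[𝕜] (Submodule.span 𝕜 S).topologicalClosure}
    (hγ : MapsBasisOnto 𝕜 ι S γ) {v : X} (hv : v ∈ S) :
    ‖v‖ ≤ ‖(γ : lp (fun _ : ι => 𝕜) 1 →L[𝕜] (Submodule.span 𝕜 S).topologicalClosure)‖ := by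
  classical
  obtain ⟨i, -, rfl⟩ := hγ.surjOn hv
  have h := (γ : lp (fun _ : ι => 𝕜) 1 →L[𝕜]
    (Submodule.span 𝕜 S).topologicalClosure).le_opNorm (lp.single 1 i (1 : 𝕜))
  rw [lp.norm_single (by simp), norm_one, mul_one] at h
  exact h

/-- A lower `ℓ₁`-estimate for members of a set equivalent to the standard basis. -/
theorem sum_norm_le_of_mapsBasisOnto {ι τ : Type*} {S : Set X}
    {γ : lp (fun _ : ι => 𝕜) 1 ≃L[𝕜] (Submodule.span 𝕜 S).topologicalClosure}
    (hγ : MapsBasisOnto 𝕜 ι S γ) (T : Finset τ) (z : τ → X) (hz : ∀ t ∈ T, z t ∈ S)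
    (hinj : Set.InjOn z T) (c : τ → 𝕜) :
    ∑ t ∈ T, ‖c t‖ ≤
      ‖(γ.symm : (Submodule.span 𝕜 S).topologicalClosure →L[𝕜] lp (fun _ : ι => 𝕜) 1)‖ *
        ‖∑ t ∈ T, c t • z t‖ := by
  classical
  have hex : ∀ t : T, ∃ i : ι, (γ (lp.single 1 i (1 : 𝕜)) : X) = z t := fun t => by
    obtain ⟨i, -, hi⟩ := hγ.surjOn (hz t t.2)
    exact ⟨i, by convert hi⟩
  choose i hi using hex
  have hiinj : Function.Injective i := by
    intro s t hst
    exact Subtype.ext (hinj s.2 t.2 (by rw [← hi, ← hi, hst]))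
  set f : lp (fun _ : ι => 𝕜) 1 := ∑ t : T, c t • lp.single 1 (i t) (1 : 𝕜) with hf
  have hγf : ((γ f : (Submodule.span 𝕜 S).topologicalClosure) : X) = ∑ t ∈ T, c t • z t := by
    rw [hf, map_sum, ← Finset.sum_coe_sort T]
    simp [hi]
  have hfi : ∀ t : T, f (i t) = c t := by
    intro t
    rw [hf, lp.coeFn_sum, Finset.sum_apply, Finset.sum_eq_single t]
    · simp
    · intro s _ hst
      simp [hiinj.ne hst.symm]
    · simp
  have h1 : ∑ t ∈ T, ‖c t‖ ≤ ‖f‖ := by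
    have := lp.sum_rpow_le_norm_rpow (p := 1) (by simp) f (Finset.univ.image i)
    rw [Finset.sum_image (hiinj.injOn)] at this
    simp only [ENNReal.toReal_one, Real.rpow_one, hfi] at this
    rwa [Finset.sum_coe_sort T fun t => ‖c t‖] at this
  refine h1.trans ?_
  have h2 := (γ.symm : (Submodule.span 𝕜 S).topologicalClosure →L[𝕜]
    lp (fun _ : ι => 𝕜) 1).le_opNorm (γ f)
  simp only [ContinuousLinearEquiv.coe_coe, γ.symm_apply_apply] at h2
  rwa [← hγf]

end EllOneLower

/-! ### Orbits with lower `ℓ₁`-estimates on proportional sets of times -/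

section Orbit

variable {𝕜 X : Type*} [RCLike 𝕜] [NormedAddCommGroup X] [NormedSpace 𝕜 X]

theorem zpow_add_apply (α : X ≃ₗᵢ[𝕜] X) (i j : ℤ) (x : X) :
    (α ^ (i + j) : X ≃ₗᵢ[𝕜] X) x = (α ^ i : X ≃ₗᵢ[𝕜] X) ((α ^ j : X ≃ₗᵢ[𝕜] X) x) := by
  rw [zpow_add]
  rfl

theorem zpow_apply_of_fixed {β : X ≃ₗᵢ[𝕜] X} {x : X} (h : β x = x) (k : ℤ) :
    (β ^ k : X ≃ₗᵢ[𝕜] X) x = x := by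
  have hinv : (β ^ (-1 : ℤ) : X ≃ₗᵢ[𝕜] X) x = x := by
    have h1 := zpow_add_apply β (-1) 1 x
    rw [zpow_one, h] at h1
    simpa using h1.symm
  induction k using Int.induction_on with
  | zero => simp
  | succ k ih => rw [zpow_add_apply, zpow_one, h, ih]
  | pred k ih => rw [sub_eq_add_neg, zpow_add_apply, hinv, ih]

/-- The orbit of `x` satisfies a uniform lower `ℓ₁`-estimate on sets of times of positive
proportion in arbitrarily long initial intervals. -/
def HasProportionalLower (α : X ≃ₗᵢ[𝕜] X) (x : X) : Prop :=
  ∃ r d : ℝ, 0 < r ∧ 0 < d ∧ ∃ᶠ n : ℕ in atTop, ∃ J ⊆ Finset.range n,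
    d * n ≤ J.card ∧ EllOneLower 𝕜 (fun i : ℕ => (α ^ i : X ≃ₗᵢ[𝕜] X) x) r J

theorem HasProportionalEllOnePieces.hasProportionalLower {α : X ≃ₗᵢ[𝕜] X} {x : X}
    (h : HasProportionalEllOnePieces α x) : HasProportionalLower α x := by
  obtain ⟨C, d, n, I, hC, hd, hn, h⟩ := h
  have hx : 0 < ‖x‖ := by
    obtain ⟨k, hk⟩ := (hn.eventually_gt_atTop 0).exists
    obtain ⟨-, hcard, γ, hγ, -⟩ := h k
    have hpos : (0 : ℝ) < (I k).card :=
      (mul_pos hd (by exact_mod_cast hk)).trans_le hcard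
    obtain ⟨i, hi⟩ := Finset.card_pos.mp (by exact_mod_cast hpos)
    rw [← (α ^ i : X ≃ₗᵢ[𝕜] X).norm_map x]
    exact norm_pos_of_mapsBasisOnto hγ ⟨i, hi, rfl⟩
  -- Orbit points are images of basis vectors and have norm `‖x‖`, so `‖x‖ ≤ ‖γ‖`. Hence `‖x‖ ‖γ⁻¹‖
  -- ≤ C`, and the lower constant `‖x‖ / C` does not depend on `k`.
  refine ⟨‖x‖ / C, d, by positivity, hd, hn.frequently (Frequently.of_forall fun k => ?_)⟩
  obtain ⟨hsub, hcard, γ, hγ, hnorm⟩ := h k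
  refine ⟨I k, hsub, hcard, fun c => ?_⟩
  rcases (I k).eq_empty_or_nonempty with he | ⟨i, hi⟩
  · simp [he]
  -- The basis is only known to correspond bijectively to the set of orbit points. That set
  -- therefore has as many elements as the finite set `I k`, which forces injectivity of the orbit
  -- map on `I k`.
  have hinj : Set.InjOn (fun i : ℕ => (α ^ i : X ≃ₗᵢ[𝕜] X) x) (I k : Set ℕ) := by
    classical
    rw [← Finset.card_image_iff, ← Set.ncard_coe_finset, Finset.coe_image, ← hγ.image_eq,
      hγ.injOn.ncard_image, Set.ncard_univ]
    simp
  have h1 := sum_norm_le_of_mapsBasisOnto hγ (I k) (fun i : ℕ => (α ^ i : X ≃ₗᵢ[𝕜] X) x)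
    (fun i hi => ⟨i, hi, rfl⟩) hinj c
  have h2 : ‖x‖ ≤ ‖(γ : lp (fun _ : I k => 𝕜) 1 →L[𝕜] (Submodule.span 𝕜
      ((fun i : ℕ => (α ^ i : X ≃ₗᵢ[𝕜] X) x) '' (I k : Set ℕ))).topologicalClosure)‖ := by
    rw [← (α ^ i : X ≃ₗᵢ[𝕜] X).norm_map x]
    exact norm_le_of_mapsBasisOnto hγ ⟨i, hi, rfl⟩
  rw [div_mul_eq_mul_div, div_le_iff₀ (by linarith)]
  calc ‖x‖ * ∑ i ∈ I k, ‖c i‖ ≤ _ * (_ * _) :=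
        mul_le_mul h2 h1 (Finset.sum_nonneg fun _ _ => norm_nonneg _) (norm_nonneg _)
    _ = (_ * _) * _ := (mul_assoc _ _ _).symm
    _ ≤ C * _ := mul_le_mul_of_nonneg_right hnorm (norm_nonneg _)
    _ = _ := mul_comm _ _

theorem HasProportionalLower.hasProportionalEllOnePieces [CompleteSpace X] {α : X ≃ₗᵢ[𝕜] X} {x : X}
    (h : HasProportionalLower α x) : HasProportionalEllOnePieces α x := by
  obtain ⟨r, d, hr, hd, h⟩ := h
  obtain ⟨n, hn, h⟩ := extraction_of_frequently_atTop h
  choose I hI hcard hlow using h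
  refine ⟨max 1 (‖x‖ * (1 / r)), d, n, I, le_max_left _ _, hd, hn.tendsto_atTop, fun k =>
    ⟨hI k, hcard k, ?_⟩⟩
  obtain ⟨γ, hγ, h1, h2⟩ := exists_equiv_of_ellOneLower (𝕜 := 𝕜)
    (fun i : I k => (α ^ (i : ℕ) : X ≃ₗᵢ[𝕜] X) x) hr (norm_nonneg x)
    (fun i => ((α ^ (i : ℕ) : X ≃ₗᵢ[𝕜] X).norm_map x).le)
    (fun J => EllOneLower.of_map (Function.Embedding.subtype _) ((hlow k).mono fun i hi => by
      obtain ⟨j, -, rfl⟩ := Finset.mem_map.mp hi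
      exact j.2))
    (S := (fun i : ℕ => (α ^ i : X ≃ₗᵢ[𝕜] X) x) '' (I k : Set ℕ)) (by
      ext v; simp)
  exact ⟨γ, hγ, (mul_le_mul h1 h2 (norm_nonneg _) (norm_nonneg _)).trans (le_max_right _ _)⟩

/-- The density halves because a set of nonnegative times is measured in the symmetric windows `{-n,
…, n}`. -/
theorem hasDensity_image_natCast {I : Set ℕ} {D : ℝ} [DecidablePred (· ∈ I)]
    (h : Tendsto (fun n : ℕ => (((Finset.range n).filter (· ∈ I)).card : ℝ) / n) atTop (𝓝 D)) :
    HasDensity ((fun i : ℕ => (i : ℤ)) '' I) (D / 2) := by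
  have hcard : ∀ n : ℕ, ((fun i : ℕ => (i : ℤ)) '' I ∩ Set.Icc (-(n : ℤ)) n).ncard =
      ((Finset.range (n + 1)).filter (· ∈ I)).card := by
    intro n
    rw [← Finset.card_image_of_injective (f := fun i : ℕ => (i : ℤ)) _ Nat.cast_injective,
      ← Set.ncard_coe_finset]
    congr 1
    ext i
    simp only [Set.mem_inter_iff, Set.mem_image, Set.mem_Icc, Finset.coe_image, Finset.coe_filter,
      Finset.mem_range, Set.mem_ofPred_eq]
    constructor
    · rintro ⟨⟨j, hj, rfl⟩, h1, h2⟩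
      exact ⟨j, ⟨by omega, hj⟩, rfl⟩
    · rintro ⟨j, ⟨h1, hj⟩, rfl⟩
      exact ⟨⟨j, hj, rfl⟩, by omega, by omega⟩
  have h1 := h.comp (tendsto_add_atTop_nat 1)
  have h2 : Tendsto (fun n : ℕ => ((n : ℝ) + 1) / (2 * n + 1)) atTop (𝓝 (1 / 2)) := by
    have h0 := tendsto_one_div_add_atTop_nhds_zero_nat (𝕜 := ℝ)
    have h3 : Tendsto (fun n : ℕ => (1 : ℝ) / (2 - 1 / ((n : ℝ) + 1))) atTop (𝓝 (1 / (2 - 0))) :=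
      tendsto_const_nhds.div (tendsto_const_nhds.sub h0) (by norm_num)
    rw [sub_zero] at h3
    refine h3.congr fun n => ?_
    have h4 : (n : ℝ) + 1 ≠ 0 := by positivity
    have h5 : 2 * (n : ℝ) + 1 ≠ 0 := by positivity
    have h6 : 2 - 1 / ((n : ℝ) + 1) = (2 * n + 1) / (n + 1) := by field_simp; ring
    rw [h6, one_div_div]
  have h3 := h1.mul h2
  rw [mul_one_div] at h3
  refine h3.congr fun n => ?_
  simp only [Function.comp, hcard]
  push_cast
  have : (n : ℝ) + 1 ≠ 0 := by positivity
  field_simp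

theorem HasProportionalLower.hasPositiveDensityEllOneSet [CompleteSpace X] {α : X ≃ₗᵢ[𝕜] X} {x : X}
    (h : HasProportionalLower α x) : HasPositiveDensityEllOneSet α x := by
  classical
  obtain ⟨r, d, hr, hd, h⟩ := h
  obtain ⟨I, D, hD, hlim, hI⟩ := exists_set_of_density
    (F := {J | EllOneLower 𝕜 (fun i : ℕ => (α ^ i : X ≃ₗᵢ[𝕜] X) x) r J})
    (fun J hJ J' hJ' => EllOneLower.mono hJ hJ')
    -- Translation invariance of the family: shifting times by `a` applies the isometry `α ^ a`.
    (fun J a hJ => by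
      have h1 := EllOneLower.of_map _ hJ
      change EllOneLower 𝕜 (fun i : ℕ => (α ^ i : X ≃ₗᵢ[𝕜] X) x) r J
      rw [← EllOneLower.comp_linearIsometry (α ^ a : X ≃ₗᵢ[𝕜] X).toLinearIsometry]
      convert h1 using 2 with i
      simp [pow_add, add_comm i a])
    hd (h.mono fun n ⟨J, h1, h2, h3⟩ => ⟨J, h3, h1, h2⟩)
  refine ⟨(fun i : ℕ => (i : ℤ)) '' I, D / 2, half_pos hD, hasDensity_image_natCast hlim, ?_⟩
  obtain ⟨γ, hγ, -⟩ := exists_equiv_of_ellOneLower (𝕜 := 𝕜)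
    (fun i : (fun i : ℕ => (i : ℤ)) '' I => (α ^ (i : ℤ) : X ≃ₗᵢ[𝕜] X) x) hr (norm_nonneg x)
    (fun i => ((α ^ (i : ℤ) : X ≃ₗᵢ[𝕜] X).norm_map x).le)
    (fun J => by
      have hnat : ∀ i : (fun i : ℕ => (i : ℤ)) '' I, ((i : ℤ).toNat : ℤ) = i ∧
          (i : ℤ).toNat ∈ I := by
        rintro ⟨_, j, hj, rfl⟩
        simpa using hj
      let e : (fun i : ℕ => (i : ℤ)) '' I ↪ ℕ := ⟨fun i => (i : ℤ).toNat, fun i j hij => by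
        have hij : (i : ℤ).toNat = (j : ℤ).toNat := hij
        exact Subtype.ext (by rw [← (hnat i).1, ← (hnat j).1, hij])⟩
      have h1 := EllOneLower.of_map e (hI (J.map e) fun i hi => by
        obtain ⟨j, -, rfl⟩ := Finset.mem_map.mp (by exact_mod_cast hi)
        exact (hnat j).2)
      convert h1 using 2 with i
      change _ = (α ^ ((i : ℤ).toNat) : X ≃ₗᵢ[𝕜] X) x
      rw [← zpow_natCast, (hnat i).1])
    (S := (fun i : ℤ => (α ^ i : X ≃ₗᵢ[𝕜] X) x) '' ((fun i : ℕ => (i : ℤ)) '' I))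
    (Set.image_eq_range (fun i : ℤ => (α ^ i : X ≃ₗᵢ[𝕜] X) x) _).symm
  exact ⟨γ, hγ⟩

theorem HasDensity.infinite {I : Set ℤ} {D : ℝ} (hD : 0 < D) (h : HasDensity I D) :
    I.Infinite := by
  intro hfin
  have h0 : Tendsto (fun n : ℕ => (I.ncard : ℝ) / (2 * (n : ℝ) + 1)) atTop (𝓝 0) := by
    refine Tendsto.div_atTop tendsto_const_nhds ?_
    exact tendsto_atTop_add_const_right _ _
      (tendsto_natCast_atTop_atTop.const_mul_atTop two_pos)
  have := le_of_tendsto_of_tendsto' h h0 fun n => by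
    have : (I ∩ Set.Icc (-(n : ℤ)) n).ncard ≤ I.ncard :=
      Set.ncard_le_ncard Set.inter_subset_left hfin
    gcongr
  linarith

/-- A coincidence between two times makes the orbit periodic, hence finite. -/
theorem injective_orbit_of_infinite {α : X ≃ₗᵢ[𝕜] X} {x : X}
    (h : (Set.range fun i : ℤ => (α ^ i : X ≃ₗᵢ[𝕜] X) x).Infinite) :
    Function.Injective fun i : ℤ => (α ^ i : X ≃ₗᵢ[𝕜] X) x := by
  intro i j hij
  by_contra hne
  refine h ?_
  set m := i - j with hm
  have hm0 : m ≠ 0 := sub_ne_zero.mpr hne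
  have hmx : (α ^ m : X ≃ₗᵢ[𝕜] X) x = x := by
    have h1 : (α ^ i : X ≃ₗᵢ[𝕜] X) x = (α ^ j : X ≃ₗᵢ[𝕜] X) x := hij
    have h2 : (α ^ m : X ≃ₗᵢ[𝕜] X) x = (α ^ (-j) : X ≃ₗᵢ[𝕜] X) ((α ^ i : X ≃ₗᵢ[𝕜] X) x) := by
      rw [← zpow_add_apply, hm, neg_add_eq_sub]
    rw [h2, h1, ← zpow_add_apply]
    simp
  refine ((Set.finite_Ico (0 : ℤ) |m|).image fun i : ℤ => (α ^ i : X ≃ₗᵢ[𝕜] X) x).subset ?_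
  rintro _ ⟨k, rfl⟩
  refine ⟨k % m, ⟨Int.emod_nonneg _ hm0, Int.emod_lt_abs _ hm0⟩, ?_⟩
  have h3 : (α ^ k : X ≃ₗᵢ[𝕜] X) x =
      (α ^ (k % m) : X ≃ₗᵢ[𝕜] X) (((α ^ m) ^ (k / m) : X ≃ₗᵢ[𝕜] X) x) := by
    rw [← zpow_mul, ← zpow_add_apply, Int.emod_add_mul_ediv]
  exact (h3.trans (by rw [zpow_apply_of_fixed hmx])).symm

/-- The isometry `α ^ n` carries the window `{-n, …, n}` to `{0, …, 2n}`. The given basis bijection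
need not be `i ↦ α ^ i x`, but it makes the orbit infinite and so without repetitions, after which
only the set of orbit points matters. -/
theorem HasPositiveDensityEllOneSet.hasProportionalLower {α : X ≃ₗᵢ[𝕜] X} {x : X}
    (h : HasPositiveDensityEllOneSet α x) : HasProportionalLower α x := by
  classical
  obtain ⟨I, D, hD, hdens, γ, hγ⟩ := h
  have hinj : Function.Injective fun i : ℤ => (α ^ i : X ≃ₗᵢ[𝕜] X) x := by
    refine injective_orbit_of_infinite fun hfin => hdens.infinite hD ?_
    have h1 := hfin.subset (Set.image_subset_range _ I)
    have h2 := Set.Finite.of_injOn hγ.mapsTo hγ.injOn h1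
    exact Set.finite_univ_iff.mp h2
  set G := ‖(γ.symm : (Submodule.span 𝕜 ((fun i : ℤ => (α ^ i : X ≃ₗᵢ[𝕜] X) x) '' I)
    ).topologicalClosure →L[𝕜] lp (fun _ : I => 𝕜) 1)‖ with hG
  have hG0 : 0 ≤ G := norm_nonneg _
  -- The summand `1` avoids a division by zero; `D / 2` leaves room for the convergence to the
  -- density.
  refine ⟨1 / (G + 1), D / 2, by positivity, half_pos hD, ?_⟩
  have htend : Tendsto (fun n : ℕ => 2 * n + 1) atTop atTop :=
    tendsto_atTop_mono (fun n => by simp only [id]; omega) tendsto_id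
  refine htend.frequently (Eventually.frequently ?_)
  filter_upwards [Tendsto.eventually_const_lt (half_lt_self hD) hdens] with n hn
  refine ⟨(Finset.range (2 * n + 1)).filter fun i : ℕ => (i : ℤ) - n ∈ I,
    Finset.filter_subset _ _, ?_, ?_⟩
  · rw [lt_div_iff₀ (by positivity)] at hn
    push_cast
    refine hn.le.trans (le_of_eq ?_)
    rw [← Finset.card_image_of_injective (f := fun i : ℕ => (i : ℤ) - n) _
      (fun i j hij => by simpa using hij), ← Set.ncard_coe_finset]
    congr 2
    ext i
    simp only [Set.mem_inter_iff, Set.mem_Icc, Finset.coe_image, Finset.coe_filter,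
      Finset.mem_range, Set.mem_ofPred_eq, Set.mem_image]
    constructor
    · rintro ⟨hi, h1, h2⟩
      have h3 : (((i + n).toNat : ℕ) : ℤ) = i + n := Int.toNat_of_nonneg (by omega)
      exact ⟨(i + n).toNat, ⟨by omega, by rw [h3]; simpa using hi⟩, by rw [h3]; ring⟩
    · rintro ⟨j, ⟨h1, hj⟩, rfl⟩
      exact ⟨hj, by omega, by omega⟩
  · have h1 : EllOneLower 𝕜 (fun i : ℕ => (α ^ ((i : ℤ) - n) : X ≃ₗᵢ[𝕜] X) x) (1 / (G + 1))
        ((Finset.range (2 * n + 1)).filter fun i : ℕ => (i : ℤ) - n ∈ I) := by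
      intro c
      have h2 := sum_norm_le_of_mapsBasisOnto hγ
        ((Finset.range (2 * n + 1)).filter fun i : ℕ => (i : ℤ) - n ∈ I)
        (fun i : ℕ => (α ^ ((i : ℤ) - n) : X ≃ₗᵢ[𝕜] X) x)
        (fun i hi => ⟨(i : ℤ) - n, (Finset.mem_filter.mp hi).2, rfl⟩)
        (fun i _ j _ hij => by simpa using hinj hij) c
      rw [← hG] at h2
      rw [one_div, inv_mul_eq_div, div_le_iff₀ (by positivity)]
      refine h2.trans ?_
      rw [mul_comm G]
      gcongr
      linarith
    rw [← EllOneLower.comp_linearIsometry (α ^ n : X ≃ₗᵢ[𝕜] X).toLinearIsometry] at h1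
    convert h1 using 2 with i
    change _ = (α ^ n : X ≃ₗᵢ[𝕜] X) _
    rw [← zpow_natCast α n, ← zpow_add_apply, ← zpow_natCast]
    simp

end Orbit

/-! ### Exponential growth and topological entropy -/

section Growth

/-- Quantifying over natural numbers above `u n` disposes of the value `⊤`, where the hypothesis is
vacuous and the bound trivial. -/
theorem coe_le_expGrowthSup_of_frequently {u : ℕ → ℕ∞} {b : ℝ}
    (h : ∃ᶠ n : ℕ in atTop, ∀ m : ℕ, u n ≤ m → Real.exp (b * n) ≤ m) :
    (b : EReal) ≤ ExpGrowth.expGrowthSup fun n => (u n : ENNReal) := by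
  refine Frequently.le_expGrowthSup (h.mono fun n hn => ?_)
  have hexp : EReal.exp ((b : EReal) * n) = ENNReal.ofReal (Real.exp (b * n)) := by
    rw [← EReal.exp_coe]
    norm_cast
  rw [hexp]
  rcases eq_or_ne (u n) ⊤ with ht | ht
  · simp [ht]
  · lift u n to ℕ using ht with m hm
    rw [ENat.toENNReal_coe]
    exact ENNReal.ofReal_le_of_le_toReal (by simpa using hn m le_rfl)

theorem exists_frequently_of_expGrowthSup_pos {u : ℕ → ℕ∞}
    (h : 0 < ExpGrowth.expGrowthSup fun n => (u n : ENNReal)) :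
    ∃ b : ℝ, 0 < b ∧ ∃ᶠ n : ℕ in atTop, ∀ m : ℕ, u n ≤ m → Real.exp (b * n) ≤ m := by
  obtain ⟨b, hb0, hb⟩ := EReal.exists_between_coe_real h
  refine ⟨b, by exact_mod_cast hb0, (ExpGrowth.frequently_exp_le hb).mono fun n hn m hm => ?_⟩
  have hexp : EReal.exp ((b : EReal) * n) = ENNReal.ofReal (Real.exp (b * n)) := by
    rw [← EReal.exp_coe]
    norm_cast
  rw [hexp] at hn
  have h1 : (u n : ENNReal) ≤ ((m : ℕ∞) : ENNReal) := ENat.toENNReal_le.mpr hm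
  rw [ENat.toENNReal_coe] at h1
  have h2 := ENNReal.toReal_mono (by simp) (hn.trans h1)
  rwa [ENNReal.toReal_ofReal (Real.exp_pos _).le, ENNReal.toReal_natCast] at h2

theorem eventually_exp_half_le {c : ℝ} (hc : 0 < c) :
    ∀ᶠ n : ℕ in atTop, Real.exp (c / 2 * n) ≤ Real.exp (c * n) / 4 := by
  have h : Tendsto (fun n : ℕ => Real.exp (c / 2 * n)) atTop atTop :=
    Real.tendsto_exp_atTop.comp (tendsto_natCast_atTop_atTop.const_mul_atTop (half_pos hc))
  filter_upwards [h.eventually_ge_atTop 4] with n hn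
  have h1 : Real.exp (c * n) = Real.exp (c / 2 * n) * Real.exp (c / 2 * n) := by
    rw [← Real.exp_add]; congr 1; ring
  rw [h1, le_div_iff₀ (by norm_num)]
  gcongr

/-- On a compact Hausdorff space the entourages are exactly the neighbourhoods of the diagonal, so
entropy can be handled without naming a uniformity. -/
theorem mem_nhdsSet_diagonal_of_continuous {K E : Type*} [TopologicalSpace K]
    [SeminormedAddCommGroup E] {f : K → E} (hf : Continuous f) {δ : ℝ} (hδ : 0 < δ) :
    {p : K × K | ‖f p.1 - f p.2‖ < δ} ∈ 𝓝ˢ (Set.diagonal K) := by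
  refine IsOpen.mem_nhdsSet (isOpen_lt (by fun_prop) continuous_const) |>.mpr ?_
  rintro ⟨p, q⟩ hpq
  have hpq : p = q := hpq
  simp [hpq, hδ]

variable {K : Type*} [TopologicalSpace K] [CompactSpace K] [T2Space K] {T : K → K}

theorem coverEntropyEntourage_le_htop {U : SetRel K K} (hU : U ∈ 𝓝ˢ (Set.diagonal K)) :
    Dynamics.coverEntropyEntourage T Set.univ U ≤ htop T := by
  let _ : UniformSpace K := uniformSpaceOfCompactR1
  exact Dynamics.coverEntropyEntourage_le_coverEntropy T Set.univ hU

theorem coe_le_htop_of_frequently {U : SetRel K K} (hU : U ∈ 𝓝ˢ (Set.diagonal K)) {b : ℝ}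
    (h : ∃ᶠ n : ℕ in atTop, ∀ s : Finset K, Dynamics.IsDynCoverOf T Set.univ U n s →
      Real.exp (b * n) ≤ s.card) : (b : EReal) ≤ htop T := by
  refine le_trans (coe_le_expGrowthSup_of_frequently (h.mono fun n hn m hm => ?_))
    (coverEntropyEntourage_le_htop hU)
  -- The strict bound by `m + 1` produces an actual cover with at most `m` points.
  have h1 : Dynamics.coverMincard T Set.univ U n < ((m + 1 : ℕ) : ℕ∞) :=
    hm.trans_lt (by exact_mod_cast Nat.lt_succ_self m)
  simp only [Dynamics.coverMincard, iInf_lt_iff] at h1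
  obtain ⟨s, hs, hlt⟩ := h1
  refine (hn s hs).trans ?_
  have : s.card < m + 1 := by exact_mod_cast hlt
  exact_mod_cast Nat.lt_succ_iff.mp this

theorem exists_frequently_of_htop_pos (h : 0 < htop T) :
    ∃ U ∈ 𝓝ˢ (Set.diagonal K), ∃ b : ℝ, 0 < b ∧ ∃ᶠ n : ℕ in atTop, ∀ s : Finset K,
      Dynamics.IsDynCoverOf T Set.univ U n s → Real.exp (b * n) ≤ s.card := by
  let _ : UniformSpace K := uniformSpaceOfCompactR1
  have h' : 0 < ⨆ U ∈ uniformity K, Dynamics.coverEntropyEntourage T Set.univ U := h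
  simp only [lt_iSup_iff] at h'
  obtain ⟨U, hU, h1⟩ := h'
  obtain ⟨b, hb, hfreq⟩ := exists_frequently_of_expGrowthSup_pos h1
  exact ⟨U, hU, b, hb, hfreq.mono fun n hn s hs => hn s.card hs.coverMincard_le_card⟩

end Growth

/-! ### Lower bounds for entropies from lower `ℓ₁`-estimates -/

section Lower

variable {𝕜 X Y : Type*} [RCLike 𝕜] [NormedAddCommGroup X] [NormedSpace 𝕜 X]
  [NormedAddCommGroup Y] [NormedSpace 𝕜 Y]

/-- Finitely many bounded vectors which nearly norm the span of a family with a lower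
`ℓ₁`-estimate are exponentially many. -/
theorem exp_le_card_of_norming {τ : Type*} {J : Finset ℕ} (hJ : J.Nonempty) {y : ℕ → X}
    {r A κ : ℝ} (hr : 0 < r) (hA : 0 < A) (hκ : 0 < κ) (hlow : EllOneLower 𝕜 y r J)
    (s : Finset τ) (g : τ → ℕ → 𝕜) (hg : ∀ t ∈ s, ∀ i, ‖g t i‖ ≤ A)
    (hnorm : ∀ c : ℕ → 𝕜, (∀ i, ‖c i‖ ≤ 1) → ∀ R, 0 ≤ R →
      (∀ t ∈ s, ‖∑ i ∈ J, c i * g t i‖ ≤ R) →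
        κ * ‖∑ i ∈ J, c i • y i‖ ≤ R + κ * r / 2 * J.card) :
    Real.exp ((κ * r / 4) ^ 2 / (8 * A ^ 2) * J.card) / 4 ≤ s.card := by
  classical
  have h := exp_le_card_of_sign_sums (ι := J) s (fun t i => g t i) hA
    (show 0 < κ * r / 4 by positivity) (fun t ht i => hg t ht i) ?_
  · simpa using h
  intro σ
  -- If all sums for `σ` stayed below `κ r / 4` times `J.card`, then `hnorm` and the lower estimate
  -- would give `κ r ≤ κ r / 4 + κ r / 2`, up to the common factor `J.card`.
  by_contra! hcon
  let c : ℕ → 𝕜 := fun i => if h : i ∈ J then (if σ ⟨i, h⟩ then 1 else -1) else 0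
  have hc1 : ∀ i ∈ J, ‖c i‖ = 1 := by
    intro i hi
    simp only [c, dif_pos hi]
    split_ifs <;> simp
  have hcJ : ∀ i : J, c i = if σ i then 1 else -1 := fun i => by simp [c]
  have h1 := hnorm c (fun i => by
    by_cases hi : i ∈ J
    · exact (hc1 i hi).le
    · simp [c, hi]) (κ * r / 4 * J.card) (by positivity) (fun t ht => by
    have h2 := (hcon t ht).le
    rw [Fintype.card_coe] at h2
    refine le_trans (le_of_eq ?_) h2
    rw [← Finset.sum_coe_sort J]
    simp only [hcJ])
  have h2 := hlow c
  rw [Finset.sum_congr rfl hc1] at h2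
  simp only [Finset.sum_const, nsmul_eq_mul, mul_one] at h2
  have h3 : (0 : ℝ) < J.card := by exact_mod_cast hJ.card_pos
  have h4 : 0 < κ * r * J.card := by positivity
  nlinarith [mul_le_mul_of_nonneg_left h2 hκ.le]

theorem norm_dualBall_apply_le (ω : DualBall 𝕜 X) (x : X) : ‖ω.1 x‖ ≤ ‖x‖ := by
  have h : ‖WeakDual.toStrongDual ω.1‖ ≤ 1 := mem_closedBall_zero_iff.mp ω.2
  simpa using (WeakDual.toStrongDual ω.1).le_of_opNorm_le h x

theorem continuous_dualBall_eval (x : X) : Continuous fun ω : DualBall 𝕜 X => ω.1 x :=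
  (WeakDual.eval_continuous x).comp continuous_subtype_val

theorem iterate_equivariant {K : Type*} {T : K → K} {α : X ≃ₗᵢ[𝕜] X} {e : K → DualBall 𝕜 X}
    (he : ∀ p v, (e (T p)).1 v = (e p).1 (α v)) (n : ℕ) (p : K) (v : X) :
    (e (T^[n] p)).1 v = (e p).1 ((α ^ n : X ≃ₗᵢ[𝕜] X) v) := by
  induction n generalizing p with
  | zero => simp
  | succ n ih =>
    rw [Function.iterate_succ_apply, ih, he, pow_succ']
    rfl

theorem norm_pos_of_ellOneLower {α : X ≃ₗᵢ[𝕜] X} {x : X} {r : ℝ} {J : Finset ℕ} (hr : 0 < r)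
    (hJ : J.Nonempty) (h : EllOneLower 𝕜 (fun i : ℕ => (α ^ i : X ≃ₗᵢ[𝕜] X) x) r J) :
    0 < ‖x‖ := by
  rw [norm_pos_iff]
  rintro rfl
  have h1 := h fun _ => 1
  have h3 : (0 : ℝ) < J.card := by exact_mod_cast hJ.card_pos
  simp at h1
  nlinarith

/-- Positive entropy of a system over the dual ball which norms `X`. -/
theorem HasProportionalLower.htop_pos {K : Type*} [TopologicalSpace K] [CompactSpace K] [T2Space K]
    {T : K → K} {α : X ≃ₗᵢ[𝕜] X} {e : K → DualBall 𝕜 X} (hec : Continuous e)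
    (he : ∀ p v, (e (T p)).1 v = (e p).1 (α v)) {κ : ℝ} (hκ : 0 < κ)
    (hnorm : ∀ (v : X) (R : ℝ), 0 ≤ R → (∀ p, ‖(e p).1 v‖ ≤ R) → κ * ‖v‖ ≤ R) {x : X}
    (h : HasProportionalLower α x) : 0 < htop T := by
  obtain ⟨r, d, hr, hd, h⟩ := h
  have h := h.and_eventually (eventually_gt_atTop 0)
  have hpos : ∀ {n : ℕ} {J : Finset ℕ}, 0 < n → d * n ≤ J.card → J.Nonempty := by
    intro n J hn hJ
    have : (0 : ℝ) < J.card := (mul_pos hd (by exact_mod_cast hn)).trans_le hJ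
    exact Finset.card_pos.mp (by exact_mod_cast this)
  obtain ⟨n₀, ⟨J₀, -, hJ₀, hl₀⟩, hn₀⟩ := h.exists
  have hx : 0 < ‖x‖ := norm_pos_of_ellOneLower hr (hpos hn₀ hJ₀) hl₀
  set c := (κ * r / 4) ^ 2 / (8 * ‖x‖ ^ 2) with hc
  have hc0 : 0 < c := by positivity
  have hb : 0 < c * d := mul_pos hc0 hd
  -- Replacing a point by its representative in a cover costs at most `κ r / 2` at each time in `J`,
  -- which is the error permitted in `exp_le_card_of_norming`.
  have hU := mem_nhdsSet_diagonal_of_continuous (f := fun p : K => (e p).1 x)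
    ((continuous_dualBall_eval x).comp hec) (show 0 < κ * r / 2 by positivity)
  refine lt_of_lt_of_le (show (0 : EReal) < ((c * d / 2 : ℝ) : EReal) by
    exact_mod_cast half_pos hb) (coe_le_htop_of_frequently hU ?_)
  refine (h.and_eventually (eventually_exp_half_le hb)).mono ?_
  rintro n ⟨⟨⟨J, hJn, hJ, hlow⟩, hn⟩, hexp⟩ s hs
  refine hexp.trans (le_trans ?_ (exp_le_card_of_norming (hpos hn hJ) hr hx hκ hlow s
    (fun t i => (e t).1 ((α ^ i : X ≃ₗᵢ[𝕜] X) x)) (fun t _ i => ?_) ?_))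
  · rw [mul_assoc]
    gcongr
  · exact (norm_dualBall_apply_le _ _).trans ((α ^ i : X ≃ₗᵢ[𝕜] X).norm_map x).le
  · intro a ha R hR hsR
    refine hnorm _ _ (by positivity) fun p => ?_
    obtain ⟨t, ht, hpt⟩ := hs (Set.mem_univ p)
    rw [Dynamics.mem_dynEntourage] at hpt
    have h1 : ∀ i ∈ J, ‖(e p).1 ((α ^ i : X ≃ₗᵢ[𝕜] X) x) - (e t).1 ((α ^ i : X ≃ₗᵢ[𝕜] X) x)‖ ≤
        κ * r / 2 := by
      intro i hi
      have := hpt i (Finset.mem_range.mp (hJn hi))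
      simp only [Set.mem_ofPred_eq, iterate_equivariant he] at this
      exact this.le
    rw [map_sum]
    simp only [map_smul, smul_eq_mul]
    have h2 : ∑ i ∈ J, a i * (e p).1 ((α ^ i : X ≃ₗᵢ[𝕜] X) x) =
        ∑ i ∈ J, a i * (e t).1 ((α ^ i : X ≃ₗᵢ[𝕜] X) x) +
        ∑ i ∈ J, a i * ((e p).1 ((α ^ i : X ≃ₗᵢ[𝕜] X) x) - (e t).1 ((α ^ i : X ≃ₗᵢ[𝕜] X) x)) := by
      rw [← Finset.sum_add_distrib]
      exact Finset.sum_congr rfl fun i _ => by ring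
    rw [h2]
    refine (norm_add_le _ _).trans (add_le_add (hsR t ht) ?_)
    rw [mul_comm, ← nsmul_eq_mul]
    refine (norm_sum_le _ _).trans (Finset.sum_le_card_nsmul _ _ _ fun i hi => ?_)
    rw [norm_mul]
    exact (mul_le_of_le_one_left (norm_nonneg _) (ha i)).trans (h1 i hi)

/-- In a factorization through `ℓ_∞^D` the `D` coordinates of `φ` almost norm the span of the orbit
points: `ψ` is contractive, `ι` is isometric, and the error is at most `r / 2` per time. Hence `D`
is exponentially large. -/
theorem HasProportionalLower.hc_pos (ι : X →ₗᵢ[𝕜] Y) {α : X ≃ₗᵢ[𝕜] X} {x : X}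
    (h : HasProportionalLower α x) : 0 < hc ι α := by
  obtain ⟨r, d, hr, hd, h⟩ := h
  have h := h.and_eventually (eventually_gt_atTop 0)
  have hpos : ∀ {n : ℕ} {J : Finset ℕ}, 0 < n → d * n ≤ J.card → J.Nonempty := by
    intro n J hn hJ
    have : (0 : ℝ) < J.card := (mul_pos hd (by exact_mod_cast hn)).trans_le hJ
    exact Finset.card_pos.mp (by exact_mod_cast this)
  obtain ⟨n₀, ⟨J₀, -, hJ₀, hl₀⟩, hn₀⟩ := h.exists
  have hx : 0 < ‖x‖ := norm_pos_of_ellOneLower hr (hpos hn₀ hJ₀) hl₀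
  set c := (1 * r / 4) ^ 2 / (8 * ‖x‖ ^ 2) with hc
  have hc0 : 0 < c := by positivity
  have hb : 0 < c * d := mul_pos hc0 hd
  have hδ : 0 < 1 * r / 2 := by positivity
  refine lt_of_lt_of_le (show (0 : EReal) < ((c * d / 2 : ℝ) : EReal) by
    exact_mod_cast half_pos hb) (le_trans ?_ (le_iSup_of_le {x} (le_iSup₂_of_le (1 * r / 2) hδ
      le_rfl)))
  refine coe_le_expGrowthSup_of_frequently
    (u := fun n => rc ι (orbitUnion α {x} n) (1 * r / 2)) ?_
  refine (h.and_eventually (eventually_exp_half_le hb)).mono ?_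
  rintro n ⟨⟨⟨J, hJn, hJ, hlow⟩, hn⟩, hexp⟩ m hm
  have h1 : rc ι (orbitUnion α {x} n) (1 * r / 2) < ((m + 1 : ℕ) : ℕ∞) :=
    lt_of_le_of_lt hm (by exact_mod_cast Nat.lt_succ_self m)
  obtain ⟨_, ⟨D, φ, ψ, ⟨hD, hφ, hψ, happ⟩, rfl⟩, hlt⟩ := sInf_lt_iff.mp h1
  have hDm : D ≤ m := Nat.lt_succ_iff.mp (by exact_mod_cast hlt)
  refine hexp.trans (le_trans ?_ ((exp_le_card_of_norming (hpos hn hJ) hr hx one_pos hlow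
    (Finset.univ : Finset (Fin D)) (fun t i => φ ((α ^ i : X ≃ₗᵢ[𝕜] X) x) t)
    (fun t _ i => ?_) ?_).trans (by simpa using hDm)))
  · rw [mul_assoc]
    gcongr
  · refine (norm_le_pi_norm _ t).trans ((φ.le_of_opNorm_le hφ _).trans ?_)
    rw [one_mul, (α ^ i : X ≃ₗᵢ[𝕜] X).norm_map]
  · intro a ha R hR hsR
    rw [one_mul]
    set v := ∑ i ∈ J, a i • (α ^ i : X ≃ₗᵢ[𝕜] X) x with hv
    have h2 : ‖φ v‖ ≤ R := by
      refine (pi_norm_le_iff_of_nonneg hR).mpr fun t => ?_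
      refine le_trans (le_of_eq ?_) (hsR t (Finset.mem_univ t))
      rw [hv, map_sum, Finset.sum_apply]
      simp
    have h3 : ‖ψ (φ v) - ι v‖ ≤ 1 * r / 2 * J.card := by
      rw [hv]
      simp only [map_sum, map_smul]
      rw [← Finset.sum_sub_distrib, mul_comm, ← nsmul_eq_mul]
      refine (norm_sum_le _ _).trans (Finset.sum_le_card_nsmul _ _ _ fun i hi => ?_)
      rw [← smul_sub, norm_smul]
      refine (mul_le_of_le_one_left (norm_nonneg _) (ha i)).trans (happ _ ?_).le
      exact Set.mem_biUnion (hJn hi) ⟨x, by simp, rfl⟩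
    have h4 : ‖ι v‖ ≤ ‖ψ (φ v)‖ + ‖ψ (φ v) - ι v‖ := by
      have := norm_sub_le (ψ (φ v)) (ψ (φ v) - ι v)
      rwa [sub_sub_cancel] at this
    have h5 : ‖ψ (φ v)‖ ≤ ‖φ v‖ := by simpa using ψ.le_of_opNorm_le hψ (φ v)
    rw [ι.norm_map] at h4
    linarith

/-- Interpolation by functionals in the dual ball. -/
theorem EllOneLower.exists_dualBall {y : ℕ → X} {r : ℝ} {J : Finset ℕ} (hr : 0 < r)
    (h : EllOneLower 𝕜 y r J) (v : ℕ → 𝕜) (hv : ∀ i ∈ J, ‖v i‖ ≤ r) :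
    ∃ ω : DualBall 𝕜 X, ∀ i ∈ J, ω.1 (y i) = v i := by
  classical
  let L : (J → 𝕜) →ₗ[𝕜] X := Fintype.linearCombination 𝕜 (fun i : J => y i)
  have hL : ∀ c, L c = ∑ i, c i • y i := fun c => Fintype.linearCombination_apply _ _ _
  have hJ : EllOneLower 𝕜 (fun i : J => y i) r Finset.univ :=
    EllOneLower.of_map (Function.Embedding.subtype _) (h.mono fun i hi => by
      obtain ⟨j, -, rfl⟩ := Finset.mem_map.mp hi
      exact j.2)
  have hlow : ∀ c, r * ∑ i, ‖c i‖ ≤ ‖L c‖ := fun c => by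
    rw [hL]
    exact hJ c
  have hinj : Function.Injective L := by
    rw [← LinearMap.ker_eq_bot, LinearMap.ker_eq_bot']
    intro c hc
    have h1 := hlow c
    rw [hc, norm_zero] at h1
    have h2 : ∑ i, ‖c i‖ ≤ 0 := by
      by_contra! hcon
      linarith [mul_pos hr hcon]
    funext i
    have h3 := (Finset.single_le_sum (fun i _ => norm_nonneg (c i)) (Finset.mem_univ i)).trans h2
    exact norm_le_zero_iff.mp h3
  let E := LinearEquiv.ofInjective L hinj
  -- The functional sending `y i` to `v i` on the span. It is contractive because `‖v i‖ ≤ r` is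
  -- matched by the lower estimate, and Hahn–Banach then extends it.
  let f₀ : LinearMap.range L →ₗ[𝕜] 𝕜 :=
    (Fintype.linearCombination 𝕜 (fun i : J => v i)) ∘ₗ E.symm.toLinearMap
  have hf₀ : ∀ u, ‖f₀ u‖ ≤ 1 * ‖u‖ := by
    intro u
    obtain ⟨c, rfl⟩ := E.surjective u
    have h1 : f₀ (E c) = ∑ i, c i • v i := by simp [f₀, Fintype.linearCombination_apply]
    rw [h1, one_mul]
    refine le_trans ?_ (hlow c)
    rw [Finset.mul_sum]
    refine norm_sum_le_of_le _ fun i _ => ?_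
    rw [norm_smul, mul_comm]
    gcongr
    exact hv i i.2
  obtain ⟨g, hg, hgn⟩ := exists_extension_norm_eq (LinearMap.range L) (f₀.mkContinuous 1 hf₀)
  refine ⟨⟨StrongDual.toWeakDual g, mem_closedBall_zero_iff.mpr ?_⟩, fun i hi => ?_⟩
  · exact hgn.le.trans (f₀.mkContinuous_norm_le zero_le_one hf₀)
  · have h1 : y i = (E (Pi.single ⟨i, hi⟩ 1) : X) := by
      change _ = L _
      simp [L]
    change g (y i) = v i
    rw [h1, hg]
    simp [f₀]

/-- Functionals in the ball attain every assignment of the `M` grid values `k r / M` along `J`. At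
resolution `r / (2 M)` distinct assignments need distinct covering points, so a cover has at least
`M ^ (d n)` points, and `d log M` is arbitrarily large. -/
theorem HasProportionalLower.htop_eq_top {α : X ≃ₗᵢ[𝕜] X} {x : X}
    (h : HasProportionalLower α x) : htop (dualHomeo (𝕜 := 𝕜) α) = ⊤ := by
  obtain ⟨r, d, hr, hd, h⟩ := h
  refine EReal.eq_top_iff_forall_lt _ |>.mpr fun b => ?_
  refine lt_of_lt_of_le (show (b : EReal) < ((b + 1 : ℝ) : EReal) by
    exact_mod_cast lt_add_one b) ?_
  obtain ⟨M, hM⟩ := exists_nat_gt (Real.exp ((b + 1) / d))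
  have hM0 : (0 : ℝ) < M := (Real.exp_pos _).trans hM
  have hU := mem_nhdsSet_diagonal_of_continuous (f := fun ω : DualBall 𝕜 X => ω.1 x)
    (continuous_dualBall_eval x) (show 0 < r / (2 * M) by positivity)
  refine coe_le_htop_of_frequently hU (h.mono ?_)
  rintro n ⟨J, hJn, hJ, hlow⟩ s hs
  have hω : ∀ k : J → Fin M, ∃ ω : DualBall 𝕜 X, ∀ i : J,
      ω.1 ((α ^ (i : ℕ) : X ≃ₗᵢ[𝕜] X) x) = ((r / M * ((k i : ℕ) : ℝ) : ℝ) : 𝕜) := by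
    classical
    intro k
    obtain ⟨ω, hω⟩ := hlow.exists_dualBall hr
      (fun i => if hi : i ∈ J then ((r / M * ((k ⟨i, hi⟩ : ℕ) : ℝ) : ℝ) : 𝕜) else 0) (by
        intro i hi
        rw [dif_pos hi, RCLike.norm_ofReal, abs_of_nonneg (by positivity)]
        have : ((k ⟨i, hi⟩ : ℕ) : ℝ) ≤ M := by exact_mod_cast (k ⟨i, hi⟩).2.le
        rw [div_mul_eq_mul_div, div_le_iff₀ hM0]
        gcongr)
    exact ⟨ω, fun i => by rw [hω i i.2, dif_pos i.2]⟩
  choose ω hω using hω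
  choose t ht hωt using fun k => hs (Set.mem_univ (ω k))
  have he : ∀ (p : DualBall 𝕜 X) (v : X), (id (dualHomeo α p)).1 v = (id p).1 (α v) :=
    fun p v => rfl
  have hclose : ∀ (k : J → Fin M) (i : J), ‖((r / M * ((k i : ℕ) : ℝ) : ℝ) : 𝕜) -
      (t k).1 ((α ^ (i : ℕ) : X ≃ₗᵢ[𝕜] X) x)‖ < r / (2 * M) := by
    intro k i
    have h1 := (Dynamics.mem_dynEntourage.mp (hωt k)) i (Finset.mem_range.mp (hJn i.2))
    have h2 := iterate_equivariant he i
    simp only [id] at h2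
    simp only [Set.mem_ofPred_eq, h2, hω] at h1
    exact h1
  have htinj : Function.Injective t := by
    intro k k' hkk
    funext i
    have h1 := hclose k i
    have h2 := hclose k' i
    rw [← hkk, norm_sub_rev] at h2
    have h3 : ‖((r / M * ((k i : ℕ) : ℝ) : ℝ) : 𝕜) - ((r / M * ((k' i : ℕ) : ℝ) : ℝ) : 𝕜)‖ <
        r / M := by
      refine lt_of_le_of_lt (norm_sub_le_norm_sub_add_norm_sub _
        ((t k).1 ((α ^ (i : ℕ) : X ≃ₗᵢ[𝕜] X) x)) _) ((add_lt_add h1 h2).trans_le (le_of_eq ?_))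
      field_simp
      norm_num
    rw [← RCLike.ofReal_sub, RCLike.norm_ofReal, ← mul_sub, abs_mul,
      abs_of_pos (show 0 < r / M by positivity), mul_lt_iff_lt_one_right (by positivity)] at h3
    have h4 : |((k i : ℕ) : ℤ) - ((k' i : ℕ) : ℤ)| < 1 := by exact_mod_cast h3
    rw [Int.abs_lt_one_iff, sub_eq_zero] at h4
    exact Fin.ext (by exact_mod_cast h4)
  have hcard : M ^ J.card ≤ s.card := by
    have := Finset.card_le_card_of_injOn (s := (Finset.univ : Finset (J → Fin M))) t
      (fun k _ => ht k) htinj.injOn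
    simpa using this
  have hb : b + 1 ≤ d * Real.log M := by
    have := (Real.lt_log_iff_exp_lt hM0).mpr hM
    rw [div_lt_iff₀ hd] at this
    linarith
  -- As `b` may be negative, `M = 1` can occur; then `b + 1 ≤ 0` and the bound is trivial.
  rcases le_or_gt (Real.log M) 0 with hlog | hlog
  · have h1 : Real.exp ((b + 1) * n) ≤ 1 := by
      rw [Real.exp_le_one_iff]
      have : b + 1 ≤ 0 := hb.trans (mul_nonpos_of_nonneg_of_nonpos hd.le hlog)
      exact mul_nonpos_of_nonpos_of_nonneg this (Nat.cast_nonneg _)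
    refine h1.trans ?_
    have h2 : 1 ≤ M ^ J.card := Nat.one_le_pow _ _ (by exact_mod_cast hM0)
    exact_mod_cast h2.trans hcard
  · calc Real.exp ((b + 1) * n) ≤ Real.exp (J.card * Real.log M) := by
          rw [Real.exp_le_exp]
          calc (b + 1) * n ≤ d * Real.log M * n := by gcongr
            _ = d * n * Real.log M := by ring
            _ ≤ _ := by gcongr
      _ = (M : ℝ) ^ J.card := by rw [Real.exp_nat_mul, Real.exp_log hM0]
      _ ≤ s.card := by exact_mod_cast hcard

end Lower

section Upper

variable {𝕜 X Y : Type*} [RCLike 𝕜] [NormedAddCommGroup X] [NormedSpace 𝕜 X]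
  [NormedAddCommGroup Y] [NormedSpace 𝕜 Y]

/-! ### Contractive approximation entropy is at most topological entropy -/

/-- The coordinates of a contraction into `ℓ_∞^d` are points of the dual ball. -/
def coordDualBall {d : ℕ} (φ : X →L[𝕜] (Fin d → 𝕜)) (hφ : ‖φ‖ ≤ 1) (j : Fin d) :
    DualBall 𝕜 X :=
  ⟨StrongDual.toWeakDual ((ContinuousLinearMap.proj j).comp φ), by
    refine mem_closedBall_zero_iff.mpr
      (ContinuousLinearMap.opNorm_le_bound _ zero_le_one fun x => ?_)
    exact (norm_le_pi_norm (φ x) j).trans (φ.le_of_opNorm_le hφ x)⟩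

/-- Start from any approximate factorization, whose dimension is uncontrolled. Its coordinates are
functionals in the ball, so replacing each by a nearby member of `s` makes the factorization pass
through `ℓ_∞^s` at an extra cost of `δ / 2`. -/
theorem rc_le_card {ι : X →ₗᵢ[𝕜] Y} (hι : IsCAEmbedding ι) {Ω : Set X} (hΩ : Ω.Finite) {δ : ℝ}
    (hδ : 0 < δ) (s : Finset (DualBall 𝕜 X))
    (hs : ∀ ω : DualBall 𝕜 X, ∃ t ∈ s, ∀ x ∈ Ω, ‖ω.1 x - t.1 x‖ < δ / 2) :
    rc ι Ω δ ≤ s.card := by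
  obtain ⟨d, φ, ψ, hd, hφ, hψ, happ⟩ := hι hΩ.toFinset (δ / 2) (half_pos hδ)
  choose t hts ht using fun j => hs (coordDualBall φ hφ j)
  have hcard : 0 < s.card := Finset.card_pos.mpr ⟨t ⟨0, hd⟩, hts _⟩
  let f := s.equivFin
  let Φ : X →L[𝕜] (Fin s.card → 𝕜) :=
    ContinuousLinearMap.pi fun k => WeakDual.toStrongDual (f.symm k).1.1
  let ρ : (Fin s.card → 𝕜) →L[𝕜] (Fin d → 𝕜) :=
    ContinuousLinearMap.pi fun j => ContinuousLinearMap.proj (f ⟨t j, hts j⟩)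
  have hΦ : ∀ x k, Φ x k = (f.symm k).1.1 x := fun x k => rfl
  have hρ : ∀ c j, ρ c j = c (f ⟨t j, hts j⟩) := fun c j => rfl
  have hρ1 : ‖ρ‖ ≤ 1 := by
    refine ContinuousLinearMap.opNorm_le_bound _ zero_le_one fun c => ?_
    rw [one_mul]
    refine (pi_norm_le_iff_of_nonneg (norm_nonneg c)).mpr fun j => ?_
    rw [hρ]
    exact norm_le_pi_norm c _
  refine sInf_le ⟨s.card, Φ, ψ.comp ρ, ⟨hcard, ?_, ?_, fun x hx => ?_⟩, rfl⟩
  · refine ContinuousLinearMap.opNorm_le_bound _ zero_le_one fun x => ?_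
    rw [one_mul]
    refine (pi_norm_le_iff_of_nonneg (norm_nonneg x)).mpr fun k => ?_
    rw [hΦ]
    exact norm_dualBall_apply_le _ _
  · exact (ψ.opNorm_comp_le ρ).trans (mul_le_one₀ hψ (norm_nonneg _) hρ1)
  · have h1 : ‖ρ (Φ x) - φ x‖ ≤ δ / 2 := by
      refine (pi_norm_le_iff_of_nonneg (half_pos hδ).le).mpr fun j => ?_
      rw [Pi.sub_apply, hρ, hΦ, f.symm_apply_apply, norm_sub_rev]
      exact (ht j x hx).le
    have h2 : ‖ψ (ρ (Φ x)) - ψ (φ x)‖ ≤ δ / 2 := by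
      rw [← map_sub]
      have := ψ.le_of_opNorm_le hψ (ρ (Φ x) - φ x)
      rw [one_mul] at this
      exact this.trans h1
    have h3 := happ x (by simpa using hx)
    have h4 := norm_sub_le_norm_sub_add_norm_sub (ψ (ρ (Φ x))) (ψ (φ x))
      (ι.toContinuousLinearMap x)
    rw [ContinuousLinearMap.comp_apply]
    linarith

theorem hc_le_htop {ι : X →ₗᵢ[𝕜] Y} (hι : IsCAEmbedding ι) (α : X ≃ₗᵢ[𝕜] X) :
    hc ι α ≤ htop (dualHomeo (𝕜 := 𝕜) α) := by
  refine iSup_le fun Ω => iSup₂_le fun δ hδ => ?_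
  let U : SetRel (DualBall 𝕜 X) (DualBall 𝕜 X) := ⋂ x ∈ Ω, {p | ‖p.1.1 x - p.2.1 x‖ < δ / 2}
  have hU : U ∈ 𝓝ˢ (Set.diagonal (DualBall 𝕜 X)) := (Filter.biInter_finset_mem Ω).mpr fun x _ =>
    mem_nhdsSet_diagonal_of_continuous (f := fun ω : DualBall 𝕜 X => ω.1 x)
      (continuous_dualBall_eval x) (half_pos hδ)
  refine le_trans ?_ (coverEntropyEntourage_le_htop hU)
  refine ExpGrowth.expGrowthSup_monotone fun n => ENat.toENNReal_le.mpr ?_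
  refine le_iInf₂ fun s hs => rc_le_card hι ?_ hδ s fun ω => ?_
  · exact Set.Finite.biUnion (Finset.finite_toSet _) fun i _ => (Finset.finite_toSet Ω).image _
  · obtain ⟨t, ht, hωt⟩ := hs (Set.mem_univ ω)
    refine ⟨t, ht, fun x hx => ?_⟩
    obtain ⟨i, hi, v, hv, rfl⟩ := Set.mem_iUnion₂.mp hx
    have h1 := (Dynamics.mem_dynEntourage.mp hωt) i (Finset.mem_range.mp hi)
    have h2 := iterate_equivariant (e := id) (T := dualHomeo α) (α := α)
      (fun (p : DualBall 𝕜 X) v => rfl) i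
    have h3 := Set.mem_iInter₂.mp h1 v hv
    simp only [id] at h2
    simpa only [Set.mem_ofPred_eq, h2] using h3

/-! ### Positive topological entropy produces lower `ℓ₁`-estimates -/

/-- The signs are adapted to the real parts or to the imaginary parts, whichever have the larger sum
of absolute values. -/
theorem exists_signs_half_sum_le {ι : Type*} (J : Finset ι) (c : ι → 𝕜) :
    ∃ σ : ι → Bool, (∑ i ∈ J, ‖c i‖) / 2 ≤ ‖∑ i ∈ J, (if σ i then (1 : 𝕜) else -1) * c i‖ := by
  have hre : ∀ i, RCLike.re ((if 0 ≤ RCLike.re (c i) then (1 : 𝕜) else -1) * c i) =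
      |RCLike.re (c i)| := by
    intro i
    split_ifs with h
    · simp [abs_of_nonneg h]
    · simp [abs_of_neg (not_le.mp h)]
  have him : ∀ i, RCLike.im ((if 0 ≤ RCLike.im (c i) then (1 : 𝕜) else -1) * c i) =
      |RCLike.im (c i)| := by
    intro i
    split_ifs with h
    · simp [abs_of_nonneg h]
    · simp [abs_of_neg (not_le.mp h)]
  have hsum : ∑ i ∈ J, ‖c i‖ ≤ ∑ i ∈ J, |RCLike.re (c i)| + ∑ i ∈ J, |RCLike.im (c i)| := by
    rw [← Finset.sum_add_distrib]
    exact Finset.sum_le_sum fun i _ => by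
      have hI : ‖(RCLike.I : 𝕜)‖ ≤ 1 := by rw [RCLike.norm_I]; split_ifs <;> norm_num
      conv_lhs => rw [← RCLike.re_add_im (c i)]
      refine (norm_add_le _ _).trans ?_
      rw [norm_mul, RCLike.norm_ofReal, RCLike.norm_ofReal]
      exact add_le_add le_rfl (mul_le_of_le_one_right (abs_nonneg _) hI)
  rcases le_total (∑ i ∈ J, |RCLike.im (c i)|) (∑ i ∈ J, |RCLike.re (c i)|) with h | h
  · refine ⟨fun i => decide (0 ≤ RCLike.re (c i)), ?_⟩
    refine le_trans ?_ (RCLike.re_le_norm _)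
    simp only [decide_eq_true_eq, map_sum, hre]
    linarith
  · refine ⟨fun i => decide (0 ≤ RCLike.im (c i)), ?_⟩
    refine le_trans ?_ (RCLike.im_le_norm _)
    simp only [decide_eq_true_eq, map_sum, him]
    linarith

/-- Functionals in the dual ball taking independently values near two distant points give a lower
`ℓ₁`-estimate. -/
theorem ellOneLower_of_independent {J : Finset ℕ} {y : ℕ → X} {a b : 𝕜} {η : ℝ}
    (hab : 8 * η ≤ ‖a - b‖)
    (h : ∀ σ : ℕ → Bool, ∃ ω : DualBall 𝕜 X, ∀ i ∈ J,
      (σ i = true → ‖ω.1 (y i) - a‖ < η) ∧ (σ i = false → ‖ω.1 (y i) - b‖ < η)) :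
    EllOneLower 𝕜 y η J := by
  intro c
  obtain ⟨σ, hσ⟩ := exists_signs_half_sum_le J c
  obtain ⟨p, hp⟩ := h σ
  -- For opposite patterns, `p - q` takes values within `2 η` of `± (a - b)` with the signs `σ`.
  -- Therefore `2 ‖v‖ ≥ 8 η (∑ ‖c i‖) / 2 - 2 η ∑ ‖c i‖`, which is twice the required bound.
  obtain ⟨q, hq⟩ := h fun i => !(σ i)
  set v := ∑ i ∈ J, c i • y i with hv
  set s : ℕ → 𝕜 := fun i => if σ i then 1 else -1 with hs
  have hw : ∀ i ∈ J, ‖(p.1 (y i) - q.1 (y i)) - s i * (a - b)‖ ≤ 2 * η := by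
    intro i hi
    cases hσi : σ i
    · have h1 := (hp i hi).2 hσi
      have h2 := (hq i hi).1 (by simp [hσi])
      have h3 : (p.1 (y i) - q.1 (y i)) - s i * (a - b) =
          (p.1 (y i) - b) - (q.1 (y i) - a) := by
        simp only [hs, hσi, Bool.false_eq_true, if_false]
        ring
      rw [h3]
      exact (norm_sub_le _ _).trans (by linarith)
    · have h1 := (hp i hi).1 hσi
      have h2 := (hq i hi).2 (by simp [hσi])
      have h3 : (p.1 (y i) - q.1 (y i)) - s i * (a - b) =
          (p.1 (y i) - a) - (q.1 (y i) - b) := by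
        simp only [hs, hσi, if_true]
        ring
      rw [h3]
      exact (norm_sub_le _ _).trans (by linarith)
  have hpq : p.1 v - q.1 v = (a - b) * ∑ i ∈ J, s i * c i +
      ∑ i ∈ J, c i * ((p.1 (y i) - q.1 (y i)) - s i * (a - b)) := by
    rw [hv, map_sum, map_sum, Finset.mul_sum, ← Finset.sum_sub_distrib, ← Finset.sum_add_distrib]
    refine Finset.sum_congr rfl fun i _ => ?_
    rw [map_smul, map_smul, smul_eq_mul, smul_eq_mul]
    ring
  have herr : ‖∑ i ∈ J, c i * ((p.1 (y i) - q.1 (y i)) - s i * (a - b))‖ ≤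
      2 * η * ∑ i ∈ J, ‖c i‖ := by
    rw [Finset.mul_sum]
    refine norm_sum_le_of_le _ fun i hi => ?_
    rw [norm_mul, mul_comm]
    gcongr
    exact hw i hi
  have hmain : 8 * η * ((∑ i ∈ J, ‖c i‖) / 2) ≤ ‖(a - b) * ∑ i ∈ J, s i * c i‖ := by
    rw [norm_mul]
    exact mul_le_mul hab hσ (by positivity) (norm_nonneg _)
  have hup : ‖p.1 v - q.1 v‖ ≤ 2 * ‖v‖ := by
    have h1 := norm_dualBall_apply_le p v
    have h2 := norm_dualBall_apply_le q v
    exact (norm_sub_le _ _).trans (by linarith)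
  have hlow : ‖(a - b) * ∑ i ∈ J, s i * c i‖ ≤ ‖p.1 v - q.1 v‖ +
      ‖∑ i ∈ J, c i * ((p.1 (y i) - q.1 (y i)) - s i * (a - b))‖ := by
    rw [eq_sub_of_add_eq hpq.symm]
    exact norm_sub_le _ _
  linarith

/-- Neighbourhoods of the diagonal are controlled by finitely many elements of a total set. -/
theorem exists_finset_total {K : Type*} [TopologicalSpace K] [CompactSpace K]
    {e : K → DualBall 𝕜 X} (hec : Continuous e) (hei : Function.Injective e) {Δ : Set X}
    (hΔ : (Submodule.span 𝕜 Δ).topologicalClosure = ⊤) {U : Set (K × K)}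
    (hU : U ∈ 𝓝ˢ (Set.diagonal K)) :
    ∃ Ω : Finset X, (Ω : Set X) ⊆ Δ ∧ ∃ δ : ℝ, 0 < δ ∧
      ∀ p q : K, (∀ x ∈ Ω, ‖(e p).1 x - (e q).1 x‖ < δ) → (p, q) ∈ U := by
  classical
  obtain ⟨V, hVo, hdV, hVU⟩ := mem_nhdsSet_iff_exists.mp hU
  have hcomp : IsCompact Vᶜ := hVo.isClosed_compl.isCompact
  have hcont : ∀ x : X, Continuous fun p : K × K => ‖(e p.1).1 x - (e p.2).1 x‖ := fun x =>
    (((continuous_dualBall_eval x).comp (hec.comp continuous_fst)).sub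
      ((continuous_dualBall_eval x).comp (hec.comp continuous_snd))).norm
  -- Each off-diagonal pair is separated by some vector of `Δ`, uniformly on a neighbourhood;
  -- compactness of `Vᶜ` leaves finitely many vectors and a common positive gap.
  have key : ∃ Ω : Finset X, (Ω : Set X) ⊆ Δ ∧ ∃ δ : ℝ, 0 < δ ∧
      ∀ p ∈ Vᶜ, ∃ x ∈ Ω, δ ≤ ‖(e p.1).1 x - (e p.2).1 x‖ := by
    refine hcomp.induction_on (p := fun S => ∃ Ω : Finset X, (Ω : Set X) ⊆ Δ ∧ ∃ δ : ℝ, 0 < δ ∧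
      ∀ p ∈ S, ∃ x ∈ Ω, δ ≤ ‖(e p.1).1 x - (e p.2).1 x‖) ?_ ?_ ?_ ?_
    · exact ⟨∅, by simp, 1, one_pos, by simp⟩
    · rintro S S' hSS ⟨Ω, hΩ, δ, hδ, h⟩
      exact ⟨Ω, hΩ, δ, hδ, fun p hp => h p (hSS hp)⟩
    · rintro S S' ⟨Ω, hΩ, δ, hδ, h⟩ ⟨Ω', hΩ', δ', hδ', h'⟩
      refine ⟨Ω ∪ Ω', by simp [hΩ, hΩ'], min δ δ', lt_min hδ hδ', ?_⟩
      rintro p (hp | hp)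
      · obtain ⟨x, hx, hle⟩ := h p hp
        exact ⟨x, Finset.mem_union_left _ hx, (min_le_left _ _).trans hle⟩
      · obtain ⟨x, hx, hle⟩ := h' p hp
        exact ⟨x, Finset.mem_union_right _ hx, (min_le_right _ _).trans hle⟩
    · rintro ⟨p, q⟩ hpq
      have hne : p ≠ q := fun h => hpq (hdV h)
      obtain ⟨x, hx, hxne⟩ : ∃ x ∈ Δ, (e p).1 x ≠ (e q).1 x := by
        by_contra! hcon
        refine hne (hei (Subtype.ext ?_))
        have hd : Dense (Submodule.span 𝕜 Δ : Set X) :=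
          Submodule.dense_iff_topologicalClosure_eq_top.mpr hΔ
        have := ContinuousLinearMap.ext_on (f := WeakDual.toStrongDual (e p).1)
          (g := WeakDual.toStrongDual (e q).1) hd hcon
        exact WeakDual.toStrongDual.injective this
      have hpos : 0 < ‖(e p).1 x - (e q).1 x‖ := norm_pos_iff.mpr (sub_ne_zero.mpr hxne)
      refine ⟨{r | ‖(e p).1 x - (e q).1 x‖ / 2 < ‖(e r.1).1 x - (e r.2).1 x‖},
        mem_nhdsWithin_of_mem_nhds ((isOpen_lt continuous_const (hcont x)).mem_nhds
          (half_lt_self hpos)), {x}, by simpa using hx, _, half_pos hpos, fun r hr =>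
          ⟨x, by simp, le_of_lt hr⟩⟩
  obtain ⟨Ω, hΩ, δ, hδ, h⟩ := key
  refine ⟨Ω, hΩ, δ, hδ, fun p q hpq => hVU ?_⟩
  by_contra hcon
  obtain ⟨x, hx, hle⟩ := h (p, q) hcon
  exact absurd (hpq x hx) (not_lt.mpr hle)

/-- A finite `η`-net for the values of functionals in the dual ball on a finite set. -/
theorem exists_finset_net {X : Type*} [NormedAddCommGroup X] (Ω : Finset X) {η : ℝ} (hη : 0 < η) :
    ∃ N : Finset 𝕜, ∀ x ∈ Ω, ∀ z : 𝕜, ‖z‖ ≤ ‖x‖ → ∃ a ∈ N, ‖z - a‖ < η := by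
  obtain ⟨t, ht, hcov⟩ := Metric.totallyBounded_iff.mp
    (isCompact_closedBall (0 : 𝕜) (∑ x ∈ Ω, ‖x‖)).totallyBounded η hη
  refine ⟨ht.toFinset, fun x hx z hz => ?_⟩
  have h1 : z ∈ Metric.closedBall (0 : 𝕜) (∑ x ∈ Ω, ‖x‖) := by
    rw [mem_closedBall_zero_iff]
    exact hz.trans (Finset.single_le_sum (f := fun x => ‖x‖) (fun _ _ => norm_nonneg _) hx)
  obtain ⟨a, ha, hza⟩ := Set.mem_iUnion₂.mp (hcov h1)
  exact ⟨a, by simpa using ha, by simpa [dist_eq_norm] using hza⟩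

theorem exists_hasProportionalLower_of_htop_pos {K : Type*} [TopologicalSpace K] [CompactSpace K]
    [T2Space K] {T : K → K} {α : X ≃ₗᵢ[𝕜] X} {e : K → DualBall 𝕜 X} (hec : Continuous e)
    (hei : Function.Injective e) (he : ∀ p v, (e (T p)).1 v = (e p).1 (α v)) {Δ : Set X}
    (hΔ : (Submodule.span 𝕜 Δ).topologicalClosure = ⊤) (h : 0 < htop T) :
    ∃ x ∈ Δ, HasProportionalLower α x := by
  classical
  obtain ⟨U, hU, b, hb, hfreq⟩ := exists_frequently_of_htop_pos h
  obtain ⟨Ω, hΩ, δ, hδ, hΩU⟩ := exists_finset_total hec hei hΔ hU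
  set η := δ / 10 with hη
  have hη0 : 0 < η := by positivity
  obtain ⟨N, hN⟩ := exists_finset_net (𝕜 := 𝕜) Ω hη0
  let Q : Finset (X × 𝕜 × 𝕜) := Ω ×ˢ N ×ˢ N
  -- An index is a time, a vector and two net points. The distance condition belongs to both sets,
  -- so pairs of close net points give empty sets: disjointness holds throughout and such indices
  -- are never in a shattered set.
  let A : ℕ × X × 𝕜 × 𝕜 → Set K := fun j =>
    {p | 8 * η ≤ ‖j.2.2.1 - j.2.2.2‖ ∧
      ‖(e p).1 ((α ^ j.1 : X ≃ₗᵢ[𝕜] X) j.2.1) - j.2.2.1‖ < η}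
  let B : ℕ × X × 𝕜 × 𝕜 → Set K := fun j =>
    {p | 8 * η ≤ ‖j.2.2.1 - j.2.2.2‖ ∧
      ‖(e p).1 ((α ^ j.1 : X ≃ₗᵢ[𝕜] X) j.2.1) - j.2.2.2‖ < η}
  have hAB : ∀ j, Disjoint (A j) (B j) := by
    intro j
    rw [Set.disjoint_left]
    rintro p ⟨h1, h2⟩ ⟨-, h3⟩
    have h4 := norm_sub_le_norm_sub_add_norm_sub j.2.2.1
      ((e p).1 ((α ^ j.1 : X ≃ₗᵢ[𝕜] X) j.2.1)) j.2.2.2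
    rw [norm_sub_rev] at h2
    linarith
  -- There are `n * Q.card` indices, so this rate allows at most `exp (b n / 2)` patterns, too few
  -- for a cover.
  obtain ⟨c, hc, hdich⟩ := exists_shatters_or_patterns
    (b := b / (2 * (Q.card + 1))) (by positivity)
  -- patterns give covers, so for the relevant times a proportional set is shattered
  have hstep : ∃ᶠ n : ℕ in atTop, ∃ x ∈ Ω, ∃ J ⊆ Finset.range n, c * n ≤ J.card ∧
      EllOneLower 𝕜 (fun i : ℕ => (α ^ i : X ≃ₗᵢ[𝕜] X) x) η J := by
    refine (hfreq.and_eventually (eventually_gt_atTop 0)).mono ?_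
    rintro n ⟨hn, hn0⟩
    have hn0' : (0 : ℝ) < n := by exact_mod_cast hn0
    have hIcard : ((Finset.range n ×ˢ Q).card : ℝ) = n * Q.card := by simp
    rcases hdich A B hAB (Finset.range n ×ˢ Q) with ⟨J, hJI, hJne, hJcard, hJ⟩ | ⟨F, hF, hFp⟩
    · have hQ : Q.Nonempty := by
        obtain ⟨j, hj⟩ := hJne
        exact ⟨j.2, (Finset.mem_product.mp (hJI hj)).2⟩
      have hmaps : ∀ j ∈ J, j.2 ∈ Q := fun j hj => (Finset.mem_product.mp (hJI hj)).2
      -- Pigeonhole over `Q` fixes the vector and the two net points, leaving a proportional set of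
      -- times.
      obtain ⟨q, hq, hqcard⟩ : ∃ q ∈ Q, c * n ≤ ((J.filter fun j => j.2 = q).card : ℝ) := by
        refine Finset.exists_le_of_sum_le hQ ?_
        have hsum := Finset.card_eq_sum_card_fiberwise (f := Prod.snd) (s := J) (t := Q) hmaps
        rw [Finset.sum_const, nsmul_eq_mul, ← Nat.cast_sum, ← hsum]
        rw [hIcard] at hJcard
        linarith
      set J' := (J.filter fun j => j.2 = q).image Prod.fst with hJ'
      have hJ'mem : ∀ i ∈ J', (i, q) ∈ J := by
        intro i hi
        obtain ⟨j, hj, rfl⟩ := Finset.mem_image.mp hi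
        obtain ⟨hjJ, rfl⟩ := Finset.mem_filter.mp hj
        exact hjJ
      have hJ'card : J'.card = (J.filter fun j => j.2 = q).card := by
        refine Finset.card_image_of_injOn fun j hj k hk hjk => ?_
        have h1 := (Finset.mem_filter.mp hj).2
        have h2 := (Finset.mem_filter.mp hk).2
        exact Prod.ext hjk (h1.trans h2.symm)
      have hJ'le : c * n ≤ J'.card := by rw [hJ'card]; exact hqcard
      have hind : ∀ σ : ℕ → Bool, ∃ p : K, ∀ i ∈ J',
          (σ i = true → p ∈ A (i, q)) ∧ (σ i = false → p ∈ B (i, q)) := by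
        intro σ
        obtain ⟨p, -, hp⟩ := hJ fun j => σ j.1
        exact ⟨p, fun i hi => hp (i, q) (hJ'mem i hi)⟩
      have hfar : 8 * η ≤ ‖q.2.1 - q.2.2‖ := by
        have hpos : (0 : ℝ) < J'.card := (mul_pos hc hn0').trans_le hJ'le
        obtain ⟨i, hi⟩ := Finset.card_pos.mp (show 0 < J'.card by exact_mod_cast hpos)
        obtain ⟨p, hp⟩ := hind fun _ => true
        exact ((hp i hi).1 rfl).1
      refine ⟨q.1, (Finset.mem_product.mp hq).1, J', fun i hi => ?_, hJ'le,
        ellOneLower_of_independent hfar fun σ => ?_⟩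
      · exact (Finset.mem_product.mp (hJI (hJ'mem i hi))).1
      · obtain ⟨p, hp⟩ := hind σ
        exact ⟨e p, fun i hi => ⟨fun h => ((hp i hi).1 h).2, fun h => ((hp i hi).2 h).2⟩⟩
    · exfalso
      let C : (ℕ × X × 𝕜 × 𝕜 → Bool) → Set K := fun σ =>
        {p | ∀ j ∈ Finset.range n ×ˢ Q, (σ j = true → p ∉ B j) ∧ (σ j = false → p ∉ A j)}
      -- Two points with the same pattern stay close: if their values differed by `δ = 10 η` at some
      -- time, nearby net points would be at least `8 η` apart, and the pattern at that index would
      -- exclude one of the two points.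
      have hC : ∀ σ, ∀ p ∈ C σ, ∀ p' ∈ C σ, (p, p') ∈ Dynamics.dynEntourage T U n := by
        intro σ p hp p' hp'
        rw [Dynamics.mem_dynEntourage]
        refine fun i hi => hΩU _ _ fun x hx => ?_
        rw [iterate_equivariant he, iterate_equivariant he]
        by_contra! hcon
        have hval : ∀ p : K, ‖(e p).1 ((α ^ i : X ≃ₗᵢ[𝕜] X) x)‖ ≤ ‖x‖ := fun p =>
          (norm_dualBall_apply_le _ _).trans ((α ^ i : X ≃ₗᵢ[𝕜] X).norm_map x).le
        obtain ⟨a, ha, hpa⟩ := hN x hx _ (hval p)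
        obtain ⟨a', ha', hpa'⟩ := hN x hx _ (hval p')
        have hfar : 8 * η ≤ ‖a - a'‖ := by
          have h1 := norm_sub_le_norm_sub_add_norm_sub ((e p).1 ((α ^ i : X ≃ₗᵢ[𝕜] X) x)) a
            ((e p').1 ((α ^ i : X ≃ₗᵢ[𝕜] X) x))
          have h2 := norm_sub_le_norm_sub_add_norm_sub a a'
            ((e p').1 ((α ^ i : X ≃ₗᵢ[𝕜] X) x))
          rw [norm_sub_rev a'] at h2
          linarith
        have hj : (i, x, a, a') ∈ Finset.range n ×ˢ Q := by
          simp [Q, hi, hx, ha, ha']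
        cases hσ : σ (i, x, a, a')
        · exact (hp _ hj).2 hσ ⟨hfar, hpa⟩
        · exact (hp' _ hj).1 hσ ⟨hfar, hpa'⟩
      -- One representative for each nonempty class; an empty class contributes no point.
      let rep : (ℕ × X × 𝕜 × 𝕜 → Bool) → Option K := fun σ =>
        if h : (C σ).Nonempty then some h.some else none
      let s : Finset K := F.biUnion fun σ => (rep σ).toFinset
      have hscard : s.card ≤ F.card := by
        refine Finset.card_biUnion_le.trans ?_
        rw [Finset.card_eq_sum_ones]
        refine Finset.sum_le_sum fun σ _ => ?_
        rw [Option.card_toFinset]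
        cases rep σ <;> simp
      have hcover : Dynamics.IsDynCoverOf T Set.univ U n s := by
        intro p _
        obtain ⟨σ, hσ, hpσ⟩ := hFp p
        have hne : (C σ).Nonempty := ⟨p, hpσ⟩
        refine ⟨hne.some, ?_, hC σ p hpσ _ hne.some_mem⟩
        simp only [s, Finset.coe_biUnion, Set.mem_iUnion]
        exact ⟨σ, hσ, by simp [rep, hne]⟩
      have h1 := hn s hcover
      have h2 : (s.card : ℝ) ≤ F.card := by exact_mod_cast hscard
      have h3 := (h1.trans h2).trans hF
      rw [Real.exp_le_exp, hIcard] at h3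
      have h4 : b / (2 * (Q.card + 1)) * (n * Q.card) ≤ b * n / 2 := by
        rw [div_mul_eq_mul_div, div_le_div_iff₀ (by positivity) two_pos]
        have : 0 ≤ b * n := by positivity
        nlinarith
      have h5 : 0 < b * n := by positivity
      linarith
  -- The vector found may depend on `n`; since `Ω` is finite, one vector serves infinitely many `n`.
  obtain ⟨x, hx, hxf⟩ : ∃ x ∈ Ω, ∃ᶠ n : ℕ in atTop, ∃ J ⊆ Finset.range n, c * n ≤ J.card ∧
      EllOneLower 𝕜 (fun i : ℕ => (α ^ i : X ≃ₗᵢ[𝕜] X) x) η J := by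
    by_contra! hcon
    refine hstep ?_
    filter_upwards [(eventually_all_finset Ω).mpr hcon] with n hn
    rintro ⟨x, hx, J, h1, h2, h3⟩
    exact hn x hx J h1 h2 h3
  exact ⟨x, hΩ hx, η, c, hη0, hc, hxf⟩

/-- If the evaluation map into `C(Z)` is an embedding, then `Z` norms `X` up to a constant. -/
theorem exists_norming_of_isEmbedding {Z : Set (DualBall 𝕜 X)} (hZ : IsClosed Z)
    (h : Topology.IsClosedEmbedding (evalOn Z)) :
    ∃ κ : ℝ, 0 < κ ∧ ∀ (v : X) (R : ℝ), 0 ≤ R → (∀ p : Z, ‖p.1.1 v‖ ≤ R) → κ * ‖v‖ ≤ R := by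
  have : CompactSpace Z := isCompact_iff_compactSpace.mp hZ.isCompact
  have h0 : evalOn Z (0 : X) = 0 := by
    ext p
    exact map_zero p.1.1
  have h2 : ∃ ε > 0, ∀ v : X, ‖evalOn Z v‖ < ε → ‖v‖ < 1 := by
    have hb : Metric.ball (0 : X) 1 ∈ 𝓝 (0 : X) := Metric.ball_mem_nhds _ one_pos
    rw [h.isInducing.nhds_eq_comap, h0, mem_comap] at hb
    obtain ⟨t, ht, hsub⟩ := hb
    obtain ⟨ε, hε, hball⟩ := Metric.mem_nhds_iff.mp ht
    refine ⟨ε, hε, fun v hv => ?_⟩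
    have := hsub (hball (by simpa using hv : evalOn Z v ∈ Metric.ball 0 ε))
    simpa using this
  obtain ⟨ε, hε, h2⟩ := h2
  refine ⟨ε / 2, half_pos hε, fun v R hR hv => ?_⟩
  -- Otherwise the unit vector in the direction of `v` would have supremum at most `ε / 2` over `Z`,
  -- and hence norm below `1`.
  by_contra! hcon
  have hvpos : 0 < ‖v‖ := by
    by_contra! hv0
    have : ‖v‖ = 0 := le_antisymm hv0 (norm_nonneg v)
    rw [this] at hcon
    linarith
  have h3 := h2 (((‖v‖⁻¹ : ℝ) : 𝕜) • v) (by
    refine lt_of_le_of_lt ((ContinuousMap.norm_le _ (half_pos hε).le).mpr fun p => ?_)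
      (half_lt_self hε)
    change ‖p.1.1 (((‖v‖⁻¹ : ℝ) : 𝕜) • v)‖ ≤ ε / 2
    rw [map_smul, norm_smul, RCLike.norm_ofReal, abs_of_pos (inv_pos.mpr hvpos),
      inv_mul_le_iff₀ hvpos, mul_comm]
    exact (hv p).trans hcon.le)
  rw [norm_smul, RCLike.norm_ofReal, abs_of_pos (inv_pos.mpr hvpos),
    inv_mul_cancel₀ hvpos.ne'] at h3
  exact lt_irrefl _ h3

end Upper

end CAEntropy

end

/-! ### The equivalences -/

theorem theorem3 {𝕜 X Y : Type*} [RCLike 𝕜]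
    [NormedAddCommGroup X] [NormedSpace 𝕜 X] [CompleteSpace X]
    [NormedAddCommGroup Y] [NormedSpace 𝕜 Y] [CompleteSpace Y]
    (ι : X →ₗᵢ[𝕜] Y) (hι : CAEntropy.IsCAEmbedding ι)
    (α : X ≃ₗᵢ[𝕜] X)
    (Z : Set (CAEntropy.DualBall 𝕜 X)) (hZ : IsClosed Z)
    (hZinv : Set.MapsTo (CAEntropy.dualHomeo α) Z Z)
    (hZemb : Topology.IsClosedEmbedding (CAEntropy.evalOn Z))
    (Δ : Set X) (hΔ : (Submodule.span 𝕜 Δ).topologicalClosure = ⊤) :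
    List.TFAE
      [0 < CAEntropy.hc ι α,
       0 < CAEntropy.htop (CAEntropy.dualHomeo (𝕜 := 𝕜) α),
       CAEntropy.htop (CAEntropy.dualHomeo (𝕜 := 𝕜) α) = ⊤,
       ∃ x : X, CAEntropy.HasProportionalEllOnePieces α x,
       ∃ x : X, CAEntropy.HasPositiveDensityEllOneSet α x,
       0 < CAEntropy.htopRestrict (CAEntropy.dualHomeo α) Z hZ hZinv,
       ∃ x ∈ Δ, CAEntropy.HasProportionalEllOnePieces α x,
       ∃ x ∈ Δ, CAEntropy.HasPositiveDensityEllOneSet α x] := by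
  have lower_to_all : ∀ x, CAEntropy.HasProportionalLower α x →
      CAEntropy.HasProportionalEllOnePieces α x ∧ CAEntropy.HasPositiveDensityEllOneSet α x :=
    fun x h => ⟨h.hasProportionalEllOnePieces, h.hasPositiveDensityEllOneSet⟩
  tfae_have 1 → 2 := fun h => h.trans_le (CAEntropy.hc_le_htop hι α)
  -- The vector is taken from `Δ` here and in `6 → 7`; the versions without `Δ` then follow by
  -- forgetting membership.
  tfae_have 2 → 7 := fun h => by
    obtain ⟨x, hx, h⟩ := CAEntropy.exists_hasProportionalLower_of_htop_pos (e := id)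
      continuous_id Function.injective_id (fun _ _ => rfl) hΔ h
    exact ⟨x, hx, h.hasProportionalEllOnePieces⟩
  tfae_have 6 → 7 := fun h => by
    have : CompactSpace Z := isCompact_iff_compactSpace.mp hZ.isCompact
    obtain ⟨x, hx, h⟩ := CAEntropy.exists_hasProportionalLower_of_htop_pos
      (T := hZinv.restrict (CAEntropy.dualHomeo α) Z Z) (e := Subtype.val)
      continuous_subtype_val Subtype.val_injective (fun _ _ => rfl) hΔ h
    exact ⟨x, hx, h.hasProportionalEllOnePieces⟩
  tfae_have 7 → 8 := fun ⟨x, hx, h⟩ =>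
    ⟨x, hx, (lower_to_all x h.hasProportionalLower).2⟩
  tfae_have 8 → 5 := fun ⟨x, _, h⟩ => ⟨x, h⟩
  tfae_have 5 → 4 := fun ⟨x, h⟩ => ⟨x, (lower_to_all x h.hasProportionalLower).1⟩
  tfae_have 4 → 3 := fun ⟨_, h⟩ => h.hasProportionalLower.htop_eq_top
  tfae_have 3 → 2 := fun h => h ▸ EReal.zero_lt_top
  tfae_have 4 → 1 := fun ⟨_, h⟩ => h.hasProportionalLower.hc_pos ι
  tfae_have 4 → 6 := fun ⟨_, h⟩ => by
    have : CompactSpace Z := isCompact_iff_compactSpace.mp hZ.isCompact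
    obtain ⟨κ, hκ, hnorm⟩ := CAEntropy.exists_norming_of_isEmbedding hZ hZemb
    exact h.hasProportionalLower.htop_pos (T := hZinv.restrict (CAEntropy.dualHomeo α) Z Z)
      (e := Subtype.val) continuous_subtype_val (fun _ _ => rfl) hκ hnorm
  tfae_finish
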